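/- A binary sequence of period $n$ is a sequence $\mathbf a=(a_0,a_1,a_2,\dots)$ with $a_j\in\{-1,1\}$ and $a_{j+n}=a_j$ for all $j\ge 0$; its autocorrelation values are $C_{\mathbf a}(t)=\sum_{i=0}^{n-1}a_i a_{i+t}$. It has 2-level autocorrelation values with constant $d$ if $C_{\mathbf a}(t)=d$ for all $1\le t\le n-1$, and it is then called perfect if $|d|$ is as small as possible among all binary sequences of period $n$ with 2-level autocorrelation values. Theorem. For every integer $n$ with $6<n\le 33895685$, there is no perfect binary sequence of period $n$ with $d=2$. -/

import Mathlib

/-- `a` is a binary sequence (entries `-1` and `1`), periodic with period `n`. -/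
def IsBinaryPeriodic (n : ℕ) (a : ℕ → ℤ) : Prop :=
  (∀ j, a j = -1 ∨ a j = 1) ∧ Function.Periodic a n

/-- The autocorrelation value `C_a(t) = ∑_{i=0}^{n-1} a_i a_{i+t}`. -/
def autocorr (n : ℕ) (a : ℕ → ℤ) (t : ℕ) : ℤ :=
  ∑ i ∈ Finset.range n, a i * a (i + t)

/-- `a` is a binary sequence of period `n` with 2-level autocorrelation values:
all nontrivial autocorrelation values `C_a(t)`, `1 ≤ t ≤ n - 1`, equal `d`. -/
def IsTwoLevel (n : ℕ) (a : ℕ → ℤ) (d : ℤ) : Prop :=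
  IsBinaryPeriodic n a ∧ ∀ t : ℕ, 1 ≤ t → t < n → autocorr n a t = d

/-- `a` is a perfect binary sequence of period `n` with nontrivial autocorrelation value `d`:
it has 2-level autocorrelation values, and `|d|` is as small as possible for the period `n`. -/
def IsPerfect (n : ℕ) (a : ℕ → ℤ) (d : ℤ) : Prop :=
  IsTwoLevel n a d ∧ ∀ (b : ℕ → ℤ) (d' : ℤ), IsTwoLevel n b d' → |d| ≤ |d'|

/-- Every autocorrelation value is congruent to the period modulo 4. -/
theorem four_dvd_autocorr_sub {n : ℕ} {a : ℕ → ℤ} (ha : IsBinaryPeriodic n a) (t : ℕ) :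
    (4 : ℤ) ∣ autocorr n a t - n := by
  obtain ⟨h1, h2⟩ := ha
  have hshift : ∑ i ∈ Finset.range n, a (i + t) = ∑ i ∈ Finset.range n, a i := by
    induction t with
    | zero => simp
    | succ t ih =>
      rw [← ih]
      have e1 := Finset.sum_range_succ' (fun i => a (i + t)) n
      have e2 := Finset.sum_range_succ (fun i => a (i + t)) n
      have e3 : a (n + t) = a (0 + t) := by rw [add_comm n t, h2 t, zero_add]
      have e4 : ∀ i, a (i + (t + 1)) = a (i + 1 + t) := fun i => by congr 1; omega
      simp only [e4]
      linarith
  have hA : (4 : ℤ) ∣ ∑ i ∈ Finset.range n, (a i - 1) * (a (i + t) - 1) := by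
    refine Finset.dvd_sum fun i _ => ?_
    rcases h1 i with h | h <;> rcases h1 (i + t) with h' | h' <;> rw [h, h'] <;> norm_num
  have hB : (2 : ℤ) ∣ ∑ i ∈ Finset.range n, (a i - 1) := by
    refine Finset.dvd_sum fun i _ => ?_
    rcases h1 i with h | h <;> rw [h] <;> norm_num
  have e : ∑ i ∈ Finset.range n, (a i - 1) * (a (i + t) - 1)
      = autocorr n a t - n - 2 * ∑ i ∈ Finset.range n, (a i - 1) := by
    have : ∀ i, (a i - 1) * (a (i + t) - 1) = a i * a (i + t) - a (i + t) - a i + 1 :=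
      fun i => by ring
    simp only [this, Finset.sum_add_distrib, Finset.sum_sub_distrib, hshift, autocorr]
    simp
    ring
  rw [e] at hA
  omega

/-- For `d = 2` the minimality of `|d|` is automatic: the perfect binary sequences with `d = 2`
are exactly the binary sequences all of whose nontrivial autocorrelation values equal `2`. -/
theorem isPerfect_two_iff {n : ℕ} (hn : 1 < n) (a : ℕ → ℤ) :
    IsPerfect n a 2 ↔ IsTwoLevel n a 2 := by
  refine ⟨fun h => h.1, fun h => ⟨h, fun b d' hb => ?_⟩⟩
  have h1 := four_dvd_autocorr_sub h.1 1
  have h2 := four_dvd_autocorr_sub hb.1 1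
  rw [h.2 1 le_rfl hn] at h1
  rw [hb.2 1 le_rfl hn] at h2
  rw [abs_of_pos (by norm_num : (0 : ℤ) < 2), le_abs]
  omega

/-! Write `n = 2v` with `v` odd. Projecting the sequence to the nontrivial character of the factor
of order two gives an array on `ZMod v` with entries in `{-1, 0, 1}` and autocorrelation `k` times a
delta, where `v = 2k + 1`. Evaluating both sums makes `k = m ^ 2` and `3m ^ 2 + 1` squares, so
Pell's equation leaves `m = 4, 15, 56, 209, 780` (`IsTwoLevel.exists_perfectArray`,
`pell_solutions`). The next solution, `m = 2911`, gives `n = 33895686`.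

Two tools act on perfect arrays, possibly after folding to a quotient group. If `-1` is a power of
`p`, a Fourier coefficient and its conjugate have equal `p`-adic valuation, so `p` divides the
entries (`IsPerfectArray.dvd_of_selfConjugate`). A common power of the primes dividing the order is
a multiplier (`IsPerfectArray.exists_translate_fixed`). Size bounds then settle every `m` except 56.

For `m = 56`, fold to `ZMod 369`. The multiplier 4 and a cubic character leave an Eisenstein-valued
array `x` on `ZMod 41`, constant on quartic classes, whose Fourier coefficients `A` satisfy `|A|² =
3136`. Correlate `x` with its decimation by the square of a generator, with transform `R`. Then
`|R|² = 3136²` is a norm equation with finitely many solutions. Moreover 2-adically `R` is a norm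
from `ℤ₂[ω]`, hence of even valuation, and this excludes the unwanted solutions
(`QuarticCorrelation.twist_eq`). The remaining value forces equality in Cauchy–Schwarz, so `x` is
constant on quadratic classes, where a small computation ends the proof
(`QuarticCorrelation.false`). -/

/-! ### Unramified `p`-adic characters -/

/-- For a prime `p` not dividing `w` there is a domain in which `p` is a uniformizer, with a
primitive additive character of `ZMod w` on which automorphisms realise multiplication by powers
of `p`. -/
theorem exists_unramified_character (p w : ℕ) [Fact p.Prime] [NeZero w] (h : ¬ p ∣ w) :
    ∃ (O : Type) (_ : CommRing O) (_ : IsDomain O) (ψ : AddChar (ZMod w) O),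
      ψ.IsPrimitive ∧ (∀ f : ℕ, ∃ τ : O ≃+* O, ∀ z, τ (ψ z) = ψ ((p : ZMod w) ^ f * z)) ∧
      (p : O) ≠ 0 ∧ ¬ IsUnit (p : O) ∧
      ∀ x : O, x ≠ 0 → ∃ (m : ℕ) (b : Oˣ), x = (p : O) ^ m * b := by
  -- The domain is the ring of Witt vectors of `k`. Teichmüller lifts supply the roots of unity, and
  -- Frobenius raises them to the power `p`.
  let k := AlgebraicClosure (ZMod p)
  have hk : (w : k) ≠ 0 := fun h0 => h ((CharP.cast_eq_zero_iff k p w).1 h0)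
  have : NeZero (w : k) := ⟨hk⟩
  obtain ⟨ζ, hζ⟩ := HasEnoughRootsOfUnity.exists_primitiveRoot k w
  have hinj : Function.Injective (WittVector.teichmuller p : k →* WittVector p k) :=
      fun x y hxy => by
    have := congrArg (fun v => WittVector.coeff v 0) hxy
    simpa using this
  have hT : IsPrimitiveRoot (WittVector.teichmuller p ζ) w := hζ.map_of_injective hinj
  have hF : (WittVector.frobeniusEquiv p k) (WittVector.teichmuller p ζ)
      = (WittVector.teichmuller p ζ) ^ p := by
    rw [WittVector.frobeniusEquiv_apply, WittVector.frobenius_eq_map_frobenius,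
      WittVector.map_teichmuller, frobenius_def, map_pow]
  refine ⟨WittVector p k, inferInstance, inferInstance, _,
    AddChar.zmodChar_primitive_of_primitive_root w hT, fun f => ?_, WittVector.p_nonzero p k,
    (WittVector.irreducible p).not_isUnit, WittVector.exists_eq_pow_p_mul'⟩
  induction f with
  | zero => exact ⟨RingEquiv.refl _, fun z => by simp⟩
  | succ f ih =>
    obtain ⟨τ, hτ⟩ := ih
    refine ⟨(WittVector.frobeniusEquiv p k).trans τ, fun z => ?_⟩
    have e : (WittVector.frobeniusEquiv p k) (AddChar.zmodChar w hT.pow_eq_one z)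
        = AddChar.zmodChar w hT.pow_eq_one ((p : ZMod w) * z) := by
      obtain ⟨m, rfl⟩ := ZMod.natCast_zmod_surjective z
      rw [← Nat.cast_mul, AddChar.zmodChar_apply', AddChar.zmodChar_apply', map_pow, hF, ← pow_mul]
    rw [RingEquiv.trans_apply, e, hτ, pow_succ, mul_assoc]

/-! ### Perfect arrays and their Fourier transforms -/

/-- A function on `ZMod w` whose periodic autocorrelation is `N` at `0` and `0` elsewhere. -/
def IsPerfectArray {w : ℕ} [NeZero w] (X : ZMod w → ℤ) (N : ℕ) : Prop :=
  ∀ s, ∑ z, X z * X (z + s) = if s = 0 then (N : ℤ) else 0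

section Character

variable {O : Type} [CommRing O] {w : ℕ} [NeZero w]

/-- The Fourier transform of an integer valued function with respect to `ψ`. -/
def fourierSum (ψ : AddChar (ZMod w) O) (X : ZMod w → ℤ) (j : ZMod w) : O :=
  ∑ z, (X z : O) * ψ (z * j)

theorem fourierSum_inversion [IsDomain O] {ψ : AddChar (ZMod w) O} (hψ : ψ.IsPrimitive)
    (X : ZMod w → ℤ)
    (s : ZMod w) : ∑ j, fourierSum ψ X j * ψ (-(s * j)) = w * X s := by
  simp only [fourierSum, Finset.sum_mul]
  rw [Finset.sum_comm]
  have : ∀ z : ZMod w, ∑ j, (X z : O) * ψ (z * j) * ψ (-(s * j))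
      = X z * if z - s = 0 then (w : O) else 0 := fun z => by
    have e := AddChar.sum_mulShift (z - s) hψ
    rw [ZMod.card, Nat.cast_ite, Nat.cast_zero] at e
    rw [← e, Finset.mul_sum]
    refine Finset.sum_congr rfl fun j _ => ?_
    rw [mul_assoc, ← AddChar.map_add_eq_mul]
    congr 2
    ring
  simp only [this, sub_eq_zero]
  simp [mul_comm]

theorem map_fourierSum {ψ : AddChar (ZMod w) O} {τ : O ≃+* O} {q : ZMod w}
    (hτ : ∀ z, τ (ψ z) = ψ (q * z)) (X : ZMod w → ℤ) (j : ZMod w) :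
    τ (fourierSum ψ X j) = fourierSum ψ X (q * j) := by
  simp only [fourierSum, map_sum, map_mul, map_intCast, hτ]
  refine Finset.sum_congr rfl fun z _ => ?_
  congr 2
  ring

theorem fourierSum_mul (ψ : AddChar (ZMod w) O) (X : ZMod w → ℤ) (t j : ZMod w) :
    fourierSum ψ X (t * j) * fourierSum ψ X (-j)
      = fourierSum ψ (fun s => ∑ z, X z * X (t * z - s)) j := by
  simp only [fourierSum, Int.cast_sum, Int.cast_mul, Finset.sum_mul]
  rw [Finset.sum_comm]
  refine Finset.sum_congr rfl fun z _ => ?_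
  rw [Finset.mul_sum]
  refine Fintype.sum_equiv (Equiv.subLeft (t * z)) _ _ fun y => ?_
  simp only [Equiv.subLeft_apply, sub_sub_cancel]
  have : ψ (z * (t * j)) * ψ (y * -j) = ψ ((t * z - y) * j) := by
    rw [← AddChar.map_add_eq_mul]
    congr 1
    ring
  rw [← this]
  ring

theorem IsPerfectArray.fourierSum_mul_neg {X : ZMod w → ℤ} {N : ℕ} (hX : IsPerfectArray X N)
    (ψ : AddChar (ZMod w) O) (j : ZMod w) :
    fourierSum ψ X j * fourierSum ψ X (-j) = N := by
  have e := fourierSum_mul ψ X 1 j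
  rw [one_mul] at e
  have h2 : (fun s => ∑ z, X z * X (1 * z - s)) = fun s => if s = 0 then (N : ℤ) else 0 := by
    funext s
    have := hX (-s)
    simpa [sub_eq_add_neg] using this
  rw [e, h2]
  simp [fourierSum]

/-- Automorphisms fix `p`, so they preserve the `p`-adic valuation. -/
theorem associated_map {p : ℕ} (h : ∀ x : O, x ≠ 0 → ∃ (m : ℕ) (b : Oˣ), x = (p : O) ^ m * b)
    (τ : O ≃+* O) (x : O) : Associated x (τ x) := by
  rcases eq_or_ne x 0 with rfl | hx
  · simp
  obtain ⟨m, b, rfl⟩ := h x hx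
  rw [map_mul, map_pow, map_natCast]
  exact ((associated_mul_unit_left _ _ b.isUnit)).trans
    (associated_mul_unit_right _ _ (b.isUnit.map τ))

theorem int_dvd_of_cast_dvd [IsDomain O] {p : ℕ} (hp : p.Prime) (h0 : (p : O) ≠ 0)
    (hu : ¬ IsUnit (p : O))
    (k : ℕ) (n : ℤ) (h : (p : O) ^ k ∣ (n : O)) : (p : ℤ) ^ k ∣ n := by
  induction k generalizing n with
  | zero => simp
  | succ k ih =>
    have h1 : (p : ℤ) ∣ n := by
      by_contra hn
      have hc : IsCoprime (p : ℤ) n :=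
          (Nat.prime_iff_prime_int.1 hp).irreducible.coprime_iff_not_dvd.2 hn
      obtain ⟨a, b, hab⟩ := hc
      have hab' : (a : O) * p + b * n = 1 := by exact_mod_cast congrArg (Int.cast : ℤ → O) hab
      refine hu (isUnit_of_dvd_one ?_)
      rw [← hab']
      exact dvd_add (Dvd.intro_left _ rfl) (Dvd.dvd.mul_left
          ((dvd_pow_self _ k.succ_ne_zero).trans h) _)
    obtain ⟨m, rfl⟩ := h1
    rw [pow_succ']
    refine mul_dvd_mul_left _ (ih m ?_)
    rw [pow_succ', Int.cast_mul, Int.cast_natCast] at h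
    exact (mul_dvd_mul_iff_left h0).1 h

/-- Fourier inversion costs only the factor `w`, which is prime to `p`. -/
theorem dvd_of_dvd_fourierSum [IsDomain O] {p : ℕ} (hp : p.Prime) (h0 : (p : O) ≠ 0)
    (hu : ¬ IsUnit (p : O))
    (hw : ¬ p ∣ w) {ψ : AddChar (ZMod w) O} (hψ : ψ.IsPrimitive) {k : ℕ} {X : ZMod w → ℤ}
    (h : ∀ j, (p : O) ^ k ∣ fourierSum ψ X j) (s : ZMod w) : (p : ℤ) ^ k ∣ X s := by
  have h1 : (p : O) ^ k ∣ ((w * X s : ℤ) : O) := by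
    rw [Int.cast_mul, Int.cast_natCast, ← fourierSum_inversion hψ]
    exact Finset.dvd_sum fun j _ => (h j).mul_right _
  refine IsCoprime.dvd_of_dvd_mul_left ?_ (int_dvd_of_cast_dvd hp h0 hu k _ h1)
  exact (Nat.isCoprime_iff_coprime.2 ((Nat.Prime.coprime_iff_not_dvd hp).2 hw)).pow_left

end Character

/-! ### Self-conjugacy and multipliers -/

/-- If `-1` is a power of `p` modulo `w`, then `p ^ a` divides every entry of a perfect array
whose order is divisible by `p ^ (2 * a)`. -/
theorem IsPerfectArray.dvd_of_selfConjugate {p w : ℕ} (hp : p.Prime) [NeZero w] (hw : ¬ p ∣ w)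
    {X : ZMod w → ℤ} {N : ℕ} (hX : IsPerfectArray X N) {a f : ℕ}
    (ha : p ^ (2 * a) ∣ N) (hf : (p : ZMod w) ^ f = -1) (s : ZMod w) : (p : ℤ) ^ a ∣ X s := by
  have := Fact.mk hp
  obtain ⟨O, _, _, ψ, hψ, hτ, h0, hu, hfac⟩ := exists_unramified_character p w hw
  obtain ⟨τ, hτ⟩ := hτ f
  rw [hf] at hτ
  refine dvd_of_dvd_fourierSum hp h0 hu hw hψ (fun j => ?_) s
  by_cases hz : fourierSum ψ X j = 0
  · simp [hz]
  have e := hX.fourierSum_mul_neg ψ j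
  rw [← neg_one_mul j, ← map_fourierSum hτ] at e
  obtain ⟨m, b, hb⟩ := hfac _ hz
  rw [hb, map_mul, map_pow, map_natCast] at e
  have hd : (p : O) ^ (2 * a) ∣ (p : O) ^ (2 * m) := by
    have h1 : (p : O) ^ (2 * a) ∣ (N : O) := by exact_mod_cast Nat.cast_dvd_cast (α := O) ha
    rw [← e, show (p : O) ^ m * b * (p ^ m * τ b) = p ^ (2 * m) * (b * τ b) by ring] at h1
    exact (IsUnit.dvd_mul_right (b.isUnit.mul (b.isUnit.map τ))).1 h1
  have := (pow_dvd_pow_iff h0 hu).1 hd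
  rw [hb]
  exact (pow_dvd_pow _ (by omega)).mul_right _

/-- The cross-correlation of a perfect array with a decimation by a common power of all primes
dividing its order is divisible by the order. -/
theorem IsPerfectArray.dvd_crossCorrelation {w : ℕ} [NeZero w] {X : ZMod w → ℤ} {N : ℕ}
    (hN : N.Coprime w) (hX : IsPerfectArray X N) {t : ZMod w}
    (ht : ∀ p : ℕ, p.Prime → p ∣ N → ∃ f : ℕ, (p : ZMod w) ^ f = t) (s : ZMod w) :
    (N : ℤ) ∣ ∑ z, X z * X (t * z - s) := by
  rw [Int.natCast_dvd, Nat.dvd_iff_prime_pow_dvd_dvd]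
  intro p k hp hk
  rcases Nat.eq_zero_or_pos k with rfl | hk0
  · simp
  have := Fact.mk hp
  have hpN : p ∣ N := (dvd_pow_self p hk0.ne').trans hk
  have hw : ¬ p ∣ w := fun h => hp.one_lt.ne' (Nat.dvd_one.1 (hN ▸ Nat.dvd_gcd hpN h))
  obtain ⟨f, hf⟩ := ht p hp hpN
  obtain ⟨O, _, _, ψ, hψ, hτ, h0, hu, hfac⟩ := exists_unramified_character p w hw
  obtain ⟨τ, hτ⟩ := hτ f
  rw [hf] at hτ
  rw [← Int.natCast_dvd, Nat.cast_pow]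
  refine dvd_of_dvd_fourierSum hp h0 hu hw hψ (X := fun s => ∑ z, X z * X (t * z - s))
    (fun j => ?_) s
  rw [← fourierSum_mul, ← map_fourierSum hτ]
  have h1 : (p : O) ^ k ∣ (N : O) := by exact_mod_cast Nat.cast_dvd_cast (α := O) hk
  rw [← hX.fourierSum_mul_neg ψ j] at h1
  exact h1.trans ((associated_map hfac τ _).mul_right _).dvd

theorem IsPerfectArray.sum_sq {w : ℕ} [NeZero w] {X : ZMod w → ℤ} {N : ℕ}
    (hX : IsPerfectArray X N) : (∑ z, X z) ^ 2 = N := by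
  rw [sq, Finset.sum_mul_sum]
  have : ∀ z, ∑ y, X z * X y = ∑ s, X z * X (z + s) := fun z =>
    (Fintype.sum_equiv (Equiv.addLeft z) _ _ fun s => rfl).symm
  simp only [this]
  rw [Finset.sum_comm]
  simp [hX _]

theorem IsPerfectArray.energy {w : ℕ} [NeZero w] {X : ZMod w → ℤ} {N : ℕ}
    (hX : IsPerfectArray X N) : ∑ z, X z ^ 2 = N := by
  have := hX 0
  simpa [sq] using this

/-- The multiplier theorem for perfect arrays: after a translation the array is invariant under
multiplication by `t`. -/
theorem IsPerfectArray.exists_translate_fixed {w : ℕ} [NeZero w] {X : ZMod w → ℤ} {N : ℕ}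
    (hN0 : N ≠ 0) (hN : N.Coprime w) (hX : IsPerfectArray X N) {t : ZMod w} (hu : IsUnit t)
    (ht : ∀ p : ℕ, p.Prime → p ∣ N → ∃ f : ℕ, (p : ZMod w) ^ f = t) :
    ∃ c, ∀ z, X (t * z + c) = X (z + c) := by
  obtain ⟨t, rfl⟩ := hu
  choose F hF using hX.dvd_crossCorrelation hN ht
  have hNz : (N : ℤ) ≠ 0 := by exact_mod_cast hN0
  -- The cross-correlation `N * F` has energy `N ^ 2`, so the integer function `F` is a single `±1`.
  have hF2 : ∑ s, F s ^ 2 = 1 := by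
    have h1 : ∑ s, (∑ z, X z * X (t * z - s)) ^ 2 = (N : ℤ) ^ 2 := by
      have h2 : ∀ s : ZMod w, (∑ z, X z * X (t * z - s)) ^ 2
          = ∑ z, ∑ y, X z * X y * (X (t * z - s) * X (t * y - s)) := fun s => by
        rw [sq, Finset.sum_mul_sum]
        refine Finset.sum_congr rfl fun z _ => Finset.sum_congr rfl fun y _ => ?_
        ring
      simp only [h2]
      rw [Finset.sum_comm]
      have h3 : ∀ z : ZMod w, ∑ s, ∑ y, X z * X y * (X (t * z - s) * X (t * y - s))
          = N * X z ^ 2 := fun z => by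
        rw [Finset.sum_comm]
        have h4 : ∀ y : ZMod w, ∑ s, X z * X y * (X (t * z - s) * X (t * y - s))
            = X z * X y * if y = z then (N : ℤ) else 0 := fun y => by
          rw [← Finset.mul_sum]
          congr 1
          have h5 := hX (t * (y - z))
          have h6 : ((t : ZMod w) * (y - z) = 0) = (y = z) := by
            rw [Units.mul_right_eq_zero, sub_eq_zero]
          simp only [h6] at h5
          rw [← h5]
          refine Fintype.sum_equiv (Equiv.subLeft (t * z : ZMod w)) _ _ fun s => ?_
          simp only [Equiv.subLeft_apply]
          congr 2
          ring
        simp only [h4]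
        simp
        ring
      simp only [h3]
      rw [← Finset.mul_sum, hX.energy, sq]
    simp only [hF, mul_pow, ← Finset.mul_sum] at h1
    exact mul_left_cancel₀ (pow_ne_zero 2 hNz) (by rw [h1, mul_one])
  obtain ⟨g, hg⟩ : ∃ g, F g ≠ 0 := by
    by_contra! h
    simp [h] at hF2
  have hg1 : F g ^ 2 = 1 := by
    have h1 : F g ^ 2 ≤ 1 := hF2 ▸ Finset.single_le_sum (f := fun s => F s ^ 2)
      (fun s _ => sq_nonneg (F s)) (Finset.mem_univ g)
    have h2 : 0 < F g ^ 2 := by positivity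
    omega
  have hre : ∑ z, X (t * z - g) ^ 2 = N := by
    rw [← hX.energy]
    exact Fintype.sum_equiv ((Units.mulLeft t).trans (Equiv.subRight g)) _ _ fun z => rfl
  have hzero : ∑ z, (X (t * z - g) - F g * X z) ^ 2 = 0 := by
    have : ∀ z : ZMod w, (X (t * z - g) - F g * X z) ^ 2
        = X (t * z - g) ^ 2 - 2 * F g * (X z * X (t * z - g)) + F g ^ 2 * X z ^ 2 :=
          fun z => by ring
    simp only [this, Finset.sum_add_distrib, Finset.sum_sub_distrib, ← Finset.mul_sum, hre,
      hX.energy, hF]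
    linear_combination (-(N : ℤ)) * hg1
  have hsign : ∀ z, X (t * z - g) = F g * X z := fun z => by
    have := (Finset.sum_eq_zero_iff_of_nonneg fun z _ => sq_nonneg _).1 hzero z (Finset.mem_univ z)
    exact sub_eq_zero.1 (pow_eq_zero_iff two_ne_zero |>.1 this)
  have hS : ∑ z, X z ≠ 0 := fun h => hNz (by rw [← hX.sum_sq, h]; rfl)
  have hone : F g = 1 := by
    have h1 : ∑ z, X (t * z - g) = ∑ z, X z :=
      Fintype.sum_equiv ((Units.mulLeft t).trans (Equiv.subRight g)) _ _ fun z => rfl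
    simp only [hsign, ← Finset.mul_sum] at h1
    exact mul_right_cancel₀ hS (by rw [h1, one_mul])
  simp only [hone, one_mul] at hsign
  have hSu : IsUnit ((∑ z, X z : ℤ) : ZMod w) := by
    have h1 : IsUnit (N : ZMod w) := (ZMod.isUnit_iff_coprime N w).2 hN
    have h2 : ((∑ z, X z : ℤ) : ZMod w) ^ 2 = N := by
      exact_mod_cast congrArg (Int.cast : ℤ → ZMod w) hX.sum_sq
    exact (isUnit_pow_iff two_ne_zero).1 (h2 ▸ h1)
  obtain ⟨S, hS'⟩ := hSu
  -- Centre of mass: the total `S` is a unit modulo `w` because `S ^ 2 = N`, so some translate has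
  -- first moment zero. Multiplication by `t` preserves that condition, which kills the residual
  -- shift `h`.
  set P : ZMod w := ∑ z, z * (X z : ZMod w)
  set c : ZMod w := ↑S⁻¹ * P
  have hshift : ∀ d : ZMod w, ∑ z, z * (X (z + d) : ZMod w) = P - d * S := fun d => by
    rw [hS', Int.cast_sum, Finset.mul_sum, ← Finset.sum_sub_distrib]
    refine Fintype.sum_equiv (Equiv.addRight d) _ _ fun z => ?_
    simp only [Equiv.coe_addRight]
    ring
  have hc : P - c * S = 0 := by
    simp only [c]
    rw [mul_comm _ P, mul_assoc, Units.inv_mul, mul_one, sub_self]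
  set h : ZMod w := ↑t⁻¹ * (c + g) - c
  have hh : ∀ z, X (t * z + c) = X (z + (c + h)) := fun z => by
    rw [← hsign (z + (c + h))]
    congr 1
    simp only [h, add_sub_cancel, mul_add, Units.mul_inv_cancel_left]
    ring
  have hh0 : h * S = 0 := by
    have h1 : ∑ z, (t * z) * (X (t * z + c) : ZMod w) = P - c * S := by
      rw [← hshift]
      exact Fintype.sum_equiv (Units.mulLeft t) _ _ fun z => rfl
    simp only [hh, mul_assoc, ← Finset.mul_sum] at h1
    rw [hshift, hc, Units.mul_right_eq_zero] at h1
    linear_combination hc - h1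
  rw [Units.mul_left_eq_zero] at hh0
  exact ⟨c, fun z => by rw [hh, hh0, add_zero]⟩

/-! ### Folding to a quotient group -/

/-- The sums of a function on `ZMod v` over the residue classes modulo a divisor `w` of `v`. -/
def residueSum {v w : ℕ} [NeZero v] (h : w ∣ v) (W : ZMod v → ℤ) (x : ZMod w) : ℤ :=
  ∑ y with ZMod.castHom h (ZMod w) y = x, W y

theorem IsPerfectArray.residueSum {v w : ℕ} [NeZero v] [NeZero w] (h : w ∣ v) {W : ZMod v → ℤ}
    {N : ℕ} (hW : IsPerfectArray W N) : IsPerfectArray (residueSum h W) N := by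
  intro s
  set π := ZMod.castHom h (ZMod w)
  have h1 : ∀ x : ZMod w, _root_.residueSum h W x * _root_.residueSum h W (x + s)
      = ∑ y with π y = x, W y * ∑ y' with π y' = π y + s, W y' := fun x => by
    rw [_root_.residueSum, Finset.sum_mul]
    refine Finset.sum_congr rfl fun y hy => ?_
    rw [(Finset.mem_filter.1 hy).2, _root_.residueSum]
  simp only [h1]
  rw [Finset.sum_fiberwise Finset.univ π fun y => W y * ∑ y' with π y' = π y + s, W y']
  have h2 : ∀ y : ZMod v, W y * ∑ y' with π y' = π y + s, W y'
      = ∑ d, if π d = s then W y * W (y + d) else 0 := fun y => by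
    rw [Finset.mul_sum, Finset.sum_filter]
    refine (Fintype.sum_equiv (Equiv.addLeft y) _ _ fun d => ?_).symm
    simp [map_add]
  simp only [h2]
  rw [Finset.sum_comm]
  have h3 : ∀ d : ZMod v, ∑ y, (if π d = s then W y * W (y + d) else 0)
      = if d = 0 then (if s = 0 then (N : ℤ) else 0) else 0 := fun d => by
    split_ifs with h1 h2 h3 h3
    all_goals simp_all [hW d, ← sq, hW.energy]
  simp [h3]

theorem card_residueClass {v w : ℕ} [NeZero v] [NeZero w] (h : w ∣ v) (x : ZMod w) :
    (Finset.univ.filter fun y : ZMod v => ZMod.castHom h (ZMod w) y = x).card = v / w := by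
  set π := ZMod.castHom h (ZMod w)
  have h1 : ∀ x : ZMod w, (Finset.univ.filter fun y : ZMod v => π y = x).card
      = (Finset.univ.filter fun y : ZMod v => π y = 0).card := fun x => by
    obtain ⟨b, rfl⟩ := ZMod.castHom_surjective h x
    refine Finset.card_equiv (Equiv.subRight b) fun y => ?_
    rw [Finset.mem_filter, Finset.mem_filter, Equiv.subRight_apply, map_sub, sub_eq_zero]
    simp only [Finset.mem_univ, true_and]
    exact Iff.rfl
  have h2 := Finset.card_eq_sum_card_fiberwise (f := π) (s := Finset.univ) (t := Finset.univ)
    fun _ _ => Finset.mem_coe.2 (Finset.mem_univ _)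
  simp only [h1] at h2
  simp only [Finset.card_univ, ZMod.card, Finset.sum_const, smul_eq_mul] at h2
  rw [h1]
  exact (Nat.div_eq_of_eq_mul_right (NeZero.pos w) h2).symm

theorem abs_residueSum_le {v w : ℕ} [NeZero v] [NeZero w] (h : w ∣ v) {W : ZMod v → ℤ}
    (hW : ∀ y, |W y| ≤ 1) (x : ZMod w) : |residueSum h W x| ≤ (v / w : ℕ) := by
  rw [← card_residueClass h x, Finset.card_eq_sum_ones, Nat.cast_sum]
  refine (Finset.abs_sum_le_sum_abs _ _).trans (Finset.sum_le_sum fun y _ => ?_)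
  simpa using hW y

/-! ### From sequences to perfect arrays -/

theorem sum_range_eq_sum_zmod {n : ℕ} [NeZero n] (f : ℕ → ℤ) :
    ∑ i ∈ Finset.range n, f i = ∑ x : ZMod n, f x.val := by
  obtain ⟨k, rfl⟩ := Nat.exists_eq_succ_of_ne_zero (NeZero.ne n)
  exact Finset.sum_range f

theorem sum_mul_shift_of_periodic {n : ℕ} [NeZero n] {g : ℕ → ℤ} (hg : Function.Periodic g n)
    (s : ZMod n) : ∑ x : ZMod n, g x.val * g (x + s).val
      = ∑ i ∈ Finset.range n, g i * g (i + s.val) := by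
  rw [sum_range_eq_sum_zmod]
  refine Finset.sum_congr rfl fun x _ => ?_
  rw [ZMod.val_add, hg.map_mod_nat]

theorem autocorr_zero {n : ℕ} {a : ℕ → ℤ} (ha : IsBinaryPeriodic n a) : autocorr n a 0 = n := by
  have : ∀ i, a i * a i = 1 := fun i => by rcases ha.1 i with h | h <;> rw [h] <;> norm_num
  simp [autocorr, this]

theorem sum_autocorr {n : ℕ} [NeZero n] {a : ℕ → ℤ} (ha : IsBinaryPeriodic n a) :
    ∑ t ∈ Finset.range n, autocorr n a t = (∑ i ∈ Finset.range n, a i) ^ 2 := by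
  simp only [sum_range_eq_sum_zmod, autocorr]
  rw [sq, Finset.sum_mul_sum, Finset.sum_comm]
  refine Finset.sum_congr rfl fun x _ => ?_
  refine Fintype.sum_equiv (Equiv.addLeft x) _ _ fun s => ?_
  rw [Equiv.coe_addLeft, ZMod.val_add, ha.2.map_mod_nat]

/-- A binary sequence with all nontrivial autocorrelations `2` gives a solution of a Pell equation
together with a perfect array with entries in `{-1, 0, 1}`. -/
theorem IsTwoLevel.exists_perfectArray {n : ℕ} (hn : 1 < n) {a : ℕ → ℤ} (h : IsTwoLevel n a 2) :
    ∃ m u : ℕ, n = 4 * m ^ 2 + 2 ∧ u ^ 2 = 3 * m ^ 2 + 1 ∧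
      ∃ W : ZMod (2 * m ^ 2 + 1) → ℤ, (∀ y, |W y| ≤ 1) ∧ IsPerfectArray W (m ^ 2) := by
  have hmod := four_dvd_autocorr_sub h.1 1
  rw [h.2 1 le_rfl hn] at hmod
  obtain ⟨k, rfl⟩ : ∃ k, n = 4 * k + 2 := ⟨n / 4, by omega⟩
  obtain ⟨v, hv⟩ : ∃ v, v = 2 * k + 1 := ⟨_, rfl⟩
  have : NeZero v := ⟨by omega⟩
  have hnv : 4 * k + 2 = v + v := by omega
  have hper : Function.Periodic a (v + v) := hnv ▸ h.1.2
  -- This is the component on which the shift by `v` acts as `-1`. Since `v` is odd, the sign `(-1)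
  -- ^ j` turns antiperiodicity into period `v`. The halving is exact because the entries are odd.
  set g : ℕ → ℤ := fun j => (-1) ^ j * ((a j - a (j + v)) / 2)
  have hg2 : ∀ j, 2 * g j = (-1) ^ j * (a j - a (j + v)) := fun j => by
    have : (a j - a (j + v)) / 2 * 2 = a j - a (j + v) := by
      rcases h.1.1 j with h1 | h1 <;> rcases h.1.1 (j + v) with h2 | h2 <;> rw [h1, h2] <;> rfl
    simp only [g]
    linear_combination (-1) ^ j * this
  have hg1 : ∀ j, |g j| ≤ 1 := fun j => by
    simp only [g, abs_mul, abs_pow, abs_neg, abs_one, one_pow, one_mul]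
    rcases h.1.1 j with h1 | h1 <;> rcases h.1.1 (j + v) with h2 | h2 <;> rw [h1, h2] <;> decide
  have hgper : Function.Periodic g v := fun j => by
    have e : (-1 : ℤ) ^ v = -1 := Odd.neg_one_pow ⟨k, hv⟩
    have : 2 * g (j + v) = 2 * g j := by
      rw [hg2, hg2, pow_add, e, add_assoc j v v, hper]
      ring
    omega
  have hcorr : ∀ t, 4 * ∑ i ∈ Finset.range v, g i * g (i + t)
      = (-1) ^ t * (autocorr (4 * k + 2) a t - autocorr (4 * k + 2) a (t + v)) := fun t => by
    rw [autocorr, autocorr, hnv, Finset.sum_range_add, Finset.sum_range_add,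
      ← Finset.sum_add_distrib, ← Finset.sum_add_distrib, ← Finset.sum_sub_distrib, Finset.mul_sum,
      Finset.mul_sum]
    refine Finset.sum_congr rfl fun i _ => ?_
    have e1 : a (v + i + (t + v)) = a (i + t) := by
      rw [← hper (i + t)]; congr 1; omega
    have e2 : (-1 : ℤ) ^ i * (-1) ^ i = 1 := by rw [← mul_pow]; norm_num
    rw [e1, show 4 * (g i * g (i + t)) = (2 * g i) * (2 * g (i + t)) by ring, hg2, hg2, pow_add,
      show i + (t + v) = i + t + v by omega, show v + i + t = i + t + v by omega,
      show v + i = i + v by omega]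
    linear_combination (-1) ^ t * (a i - a (i + v)) * (a (i + t) - a (i + t + v)) * e2
  have hW : IsPerfectArray (fun x : ZMod v => g x.val) k := fun s => by
    rw [sum_mul_shift_of_periodic hgper]
    have e := hcorr s.val
    have hlt := ZMod.val_lt s
    rw [h.2 (s.val + v) (by omega) (by omega)] at e
    split_ifs with hs
    · subst hs
      rw [ZMod.val_zero, autocorr_zero h.1] at e
      rw [ZMod.val_zero]
      push_cast at e
      linarith
    · have : s.val ≠ 0 := fun h0 => hs ((ZMod.val_eq_zero s).1 h0)
      rw [h.2 s.val (by omega) (by omega), sub_self, mul_zero] at e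
      linarith
  obtain ⟨m, hm⟩ : ∃ m : ℕ, k = m ^ 2 := ⟨(∑ x : ZMod v, g x.val).natAbs, by
    have := hW.sum_sq
    zify
    rw [sq_abs, this]⟩
  -- The squared sum is `n + 2 * (n - 1)`.
  have hs : (∑ i ∈ Finset.range (4 * k + 2), a i) ^ 2 = 12 * (m : ℤ) ^ 2 + 4 := by
    rw [← sum_autocorr h.1, Finset.sum_range_succ', autocorr_zero h.1,
      Finset.sum_congr rfl fun t ht => h.2 (t + 1) (by omega)
        (by have := Finset.mem_range.1 ht; omega), hm]
    simp
    ring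
  obtain ⟨u, hu⟩ : (2 : ℤ) ∣ ∑ i ∈ Finset.range (4 * k + 2), a i :=
    Int.prime_two.dvd_of_dvd_pow (n := 2) ⟨6 * (m : ℤ) ^ 2 + 2, by rw [hs]; ring⟩
  subst hm hv
  refine ⟨m, u.natAbs, rfl, ?_, fun x => g x.val, fun y => hg1 _, hW⟩
  zify
  rw [sq_abs]
  rw [hu] at hs
  linarith

/-! ### The Pell equation -/

/-- Division by the fundamental unit `2 + √3`. The ratio `7 / 25` follows from `u / m > 43 / 25`, a
lower approximation to `√3`. It makes seven descents bring any `m ≤ 2910` down to zero. -/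
theorem pell_descent {m u : ℕ} (h : u ^ 2 = 3 * m ^ 2 + 1) :
    m = 0 ∧ u = 1 ∨ ∃ m' u' : ℕ, u' ^ 2 = 3 * m' ^ 2 + 1 ∧ m = 2 * m' + u' ∧
      u = 3 * m' + 2 * u' ∧ 25 * m' ≤ 7 * m := by
  rcases Nat.eq_zero_or_pos m with rfl | hm
  · left
    exact ⟨rfl, by nlinarith⟩
  right
  have h1 : u ≤ 2 * m := by nlinarith
  have h2 : 3 * m ≤ 2 * u := by nlinarith
  have h3 : 43 * m ≤ 25 * u := by nlinarith
  refine ⟨2 * m - u, 2 * u - 3 * m, ?_, by omega, by omega, by omega⟩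
  zify [h1, h2] at h ⊢
  linear_combination h

theorem pell_solutions {m u : ℕ} (h : u ^ 2 = 3 * m ^ 2 + 1) (h2 : 2 ≤ m) (hm : m ≤ 2910) :
    m = 4 ∨ m = 15 ∨ m = 56 ∨ m = 209 ∨ m = 780 := by
  rcases pell_descent h with h | ⟨m₁, u₁, h, _, _, _⟩
  · omega
  rcases pell_descent h with h | ⟨m₂, u₂, h, _, _, _⟩
  · omega
  rcases pell_descent h with h | ⟨m₃, u₃, h, _, _, _⟩
  · omega
  rcases pell_descent h with h | ⟨m₄, u₄, h, _, _, _⟩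
  · omega
  rcases pell_descent h with h | ⟨m₅, u₅, h, _, _, _⟩
  · omega
  rcases pell_descent h with h | ⟨m₆, u₆, h, _, _, _⟩
  · omega
  rcases pell_descent h with h | ⟨m₇, u₇, h, _, _, _⟩
  · omega
  rcases pell_descent h with h | ⟨m₈, u₈, h, _, _, _⟩
  · omega
  have : u₈ ≠ 0 := by rintro rfl; simp at h
  omega

/-! ### The cases `m = 4, 15, 780, 209` -/

theorem IsPerfectArray.ne_zero {w : ℕ} [NeZero w] {X : ZMod w → ℤ} {N : ℕ} (hN : N ≠ 0)
    (hX : IsPerfectArray X N) : ∃ z, X z ≠ 0 := by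
  by_contra! h
  have := hX.energy
  simp only [h] at this
  exact hN (by simpa using this.symm)

theorem zmod_pow_eq {a b f w : ℕ} (h : a ^ f % w = b % w) : (a : ZMod w) ^ f = b := by
  rw [← Nat.cast_pow]
  exact (ZMod.natCast_eq_natCast_iff' _ _ w).2 h

theorem zmod_eq_neg_one {b w : ℕ} (h : w = b + 1) : (b : ZMod w) = -1 := by
  rw [eq_neg_iff_add_eq_zero, ← Nat.cast_one, ← Nat.cast_add, ← h, ZMod.natCast_self]

theorem no_perfectArray_33 {W : ZMod 33 → ℤ} (hb : ∀ y, |W y| ≤ 1)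
    (hW : IsPerfectArray W (4 ^ 2)) : False := by
  obtain ⟨z, hz⟩ := hW.ne_zero (by norm_num)
  have h2 := hW.dvd_of_selfConjugate Nat.prime_two (by norm_num) (a := 2) (f := 5) (by norm_num)
    (by decide) z
  have := abs_le.1 (hb z)
  norm_num at h2
  omega

theorem no_perfectArray_451 {W : ZMod 451 → ℤ} (hb : ∀ y, |W y| ≤ 1)
    (hW : IsPerfectArray W (15 ^ 2)) : False := by
  -- Both 3 and 5 are self-conjugate modulo 41. Folded entries are multiples of 15 bounded by `451 /
  -- 41 = 11`.
  have h : 41 ∣ 451 := by norm_num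
  obtain ⟨z, hz⟩ := (hW.residueSum h).ne_zero (by norm_num)
  have h3 := (hW.residueSum h).dvd_of_selfConjugate Nat.prime_three (by norm_num) (a := 1) (f := 4)
    (by norm_num) (by decide) z
  have h5 := (hW.residueSum h).dvd_of_selfConjugate Nat.prime_five (by norm_num) (a := 1) (f := 10)
    (by norm_num) (by decide) z
  have := abs_le.1 (abs_residueSum_le h hb z)
  norm_num at h3 h5 this
  omega

theorem no_perfectArray_1216801 {W : ZMod 1216801 → ℤ} (hb : ∀ y, |W y| ≤ 1)
    (hW : IsPerfectArray W (780 ^ 2)) : False := by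
  obtain ⟨z, hz⟩ := hW.ne_zero (by norm_num)
  have h2 := hW.dvd_of_selfConjugate Nat.prime_two (by norm_num) (a := 1) (f := 20235) (by norm_num)
    (by
      -- The exponent is factored so that the intermediate powers stay small.
      rw [show 20235 = 15 * 19 * 71 by norm_num, pow_mul, pow_mul,
        zmod_pow_eq (show 2 ^ 15 % 1216801 = 32768 % 1216801 by norm_num),
        zmod_pow_eq (show 32768 ^ 19 % 1216801 = 403696 % 1216801 by norm_num),
        zmod_pow_eq (show 403696 ^ 71 % 1216801 = 1216800 % 1216801 by norm_num)]
      exact zmod_eq_neg_one rfl) z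
  have := abs_le.1 (hb z)
  norm_num at h2
  omega

theorem orderOf_eleven_mod_571 : orderOf ((11 : ℕ) : ZMod 571) = 285 := by
  have h : ∀ f b, 11 ^ f % 571 = b % 571 → b % 571 ≠ 1 → ((11 : ℕ) : ZMod 571) ^ f ≠ 1 :=
    fun f b h hb he => by
      rw [zmod_pow_eq h, ← Nat.cast_one, ZMod.natCast_eq_natCast_iff'] at he
      exact hb he
  refine orderOf_eq_of_pow_and_pow_div_prime (by norm_num) ?_ fun p hp hd => ?_
  · rw [show 285 = 15 * 19 by norm_num, pow_mul,
      zmod_pow_eq (show 11 ^ 15 % 571 = 407 % 571 by norm_num),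
      zmod_pow_eq (show 407 ^ 19 % 571 = 1 % 571 by norm_num), Nat.cast_one]
  have : p = 3 ∨ p = 5 ∨ p = 19 := by
    rw [show 285 = 3 * 5 * 19 by norm_num, hp.dvd_mul, hp.dvd_mul,
      Nat.prime_dvd_prime_iff_eq hp (by norm_num), Nat.prime_dvd_prime_iff_eq hp (by norm_num),
      Nat.prime_dvd_prime_iff_eq hp (by norm_num)] at hd
    tauto
  rcases this with rfl | rfl | rfl
  · exact h 95 461 (by norm_num) (by norm_num)
  · exact h 57 387 (by norm_num) (by norm_num)
  · exact h 15 407 (by norm_num) (by norm_num)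

theorem no_perfectArray_87363 {W : ZMod 87363 → ℤ} (hb : ∀ y, |W y| ≤ 1)
    (hW : IsPerfectArray W (209 ^ 2)) : False := by
  have h : 571 ∣ 87363 := by norm_num
  have : Fact (Nat.Prime 571) := ⟨by norm_num⟩
  have hX := hW.residueSum h
  have hbX := abs_residueSum_le h hb
  set X := residueSum h W
  have h19 := hX.dvd_of_selfConjugate (p := 19) (by norm_num) (by norm_num) (a := 1) (f := 285)
    (by norm_num) (by
      rw [show 285 = 15 * 19 by norm_num, pow_mul,
        zmod_pow_eq (show 19 ^ 15 % 571 = 248 % 571 by norm_num),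
        zmod_pow_eq (show 248 ^ 19 % 571 = 570 % 571 by norm_num)]
      exact zmod_eq_neg_one rfl)
  obtain ⟨c, hc⟩ := hX.exists_translate_fixed (by norm_num) (by norm_num) (t := (11 : ℕ))
    ((ZMod.isUnit_iff_coprime 11 571).2 (by norm_num)) fun p hp hd => by
      have hd' := hp.dvd_of_dvd_pow hd
      rw [show 209 = 11 * 19 by norm_num, hp.dvd_mul,
        Nat.prime_dvd_prime_iff_eq hp (by norm_num),
        Nat.prime_dvd_prime_iff_eq hp (by norm_num)] at hd'
      rcases hd' with rfl | rfl
      exacts [⟨1, pow_one _⟩, ⟨154, zmod_pow_eq (by norm_num)⟩]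
  have hpow : ∀ (k : ℕ) (z : ZMod 571), X ((11 : ℕ) ^ k * z + c) = X (z + c) := fun k => by
    induction k with
    | zero => simp
    | succ k ih => intro z; rw [pow_succ, mul_assoc, ih, hc]
  have hE : ∑ z, X (z + c) ^ 2 = 209 ^ 2 := by
    have := hX.energy
    rw [← Fintype.sum_equiv (Equiv.addRight c) _ _ fun z => rfl] at this
    exact_mod_cast this
  -- A nonzero entry off the centre would repeat along an orbit of length 285 as a multiple of 19,
  -- and `285 * 19 ^ 2 > 209 ^ 2`. The central entry alone would then be `±209`, beyond the bound
  -- `87363 / 571 = 153`.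
  have hz : ∀ z : ZMod 571, z ≠ 0 → X (z + c) = 0 := fun z hz => by
    by_contra hne
    have hinj : Set.InjOn (fun k => ((11 : ℕ) : ZMod 571) ^ k * z) (Finset.range 285) :=
      fun k hk l hl hkl => by
        refine pow_injOn_Iio_orderOf ?_ ?_ (mul_right_cancel₀ hz hkl) <;>
          rw [orderOf_eleven_mod_571]
        exacts [Finset.mem_range.1 hk, Finset.mem_range.1 hl]
    have h1 : ∑ y ∈ (Finset.range 285).image (fun k => ((11 : ℕ) : ZMod 571) ^ k * z), X (y + c) ^ 2
        ≤ ∑ y, X (y + c) ^ 2 :=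
      Finset.sum_le_sum_of_subset_of_nonneg (Finset.subset_univ _) fun _ _ _ => sq_nonneg _
    rw [hE, Finset.sum_image hinj] at h1
    simp only [hpow] at h1
    obtain ⟨q, hq⟩ := h19 (z + c)
    rw [hq] at h1 hne
    have : 1 ≤ q ^ 2 := by
      have : q ≠ 0 := by rintro rfl; simp at hne
      have := sq_pos_of_ne_zero this
      omega
    simp at h1
    nlinarith
  rw [Finset.sum_eq_single 0 (fun z _ h0 => by rw [hz z h0]; rfl) (by simp)] at hE
  have := abs_le.1 (hbX (0 + c))
  norm_num at this hE
  nlinarith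

/-! ### Eisenstein arrays on quartic classes modulo 41 -/

/-- The trace of `a * conj b` for Eisenstein integers `a.1 + a.2 * ω` and `b.1 + b.2 * ω`. -/
def eisTrace (a b : ℤ × ℤ) : ℤ := 2 * a.1 * b.1 + 2 * a.2 * b.2 - a.1 * b.2 - a.2 * b.1

/-- The norm of an Eisenstein integer. -/
def eisNorm (a : ℤ × ℤ) : ℤ := a.1 ^ 2 - a.1 * a.2 + a.2 ^ 2

/-- The coefficient of `1` in `a * conj b` for Eisenstein integers `a` and `b`. -/
def eisRe (a b : ℤ × ℤ) : ℤ := a.1 * b.1 + a.2 * b.2 - a.1 * b.2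

/-- The coefficient of `ω` in `a * conj b` for Eisenstein integers `a` and `b`. -/
def eisIm (a b : ℤ × ℤ) : ℤ := a.2 * b.1 - a.1 * b.2

/-- The cyclotomic class of order four of a residue modulo `41`; `0` is a class of its own. -/
def quarticClass (z : ZMod 41) : Fin 5 :=
  if z = 0 then 0 else if z ^ 10 = 1 then 1 else if z ^ 10 = 32 then 2 else if z ^ 10 = 40 then 3
  else 4

/-- The autocorrelation of `a` at class `0`. -/
def quarticCorr₀ (a : Fin 5 → ℤ × ℤ) : ℤ :=
  eisTrace (a 0) (a 0) + 10 * eisTrace (a 1) (a 1) + 10 * eisTrace (a 2) (a 2)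
    + 10 * eisTrace (a 3) (a 3) + 10 * eisTrace (a 4) (a 4)

/-- The autocorrelation of `a` at class `1`. -/
def quarticCorr₁ (a : Fin 5 → ℤ × ℤ) : ℤ :=
  2 * eisTrace (a 0) (a 1) + 8 * eisTrace (a 1) (a 2) + 6 * eisTrace (a 1) (a 3)
    + 4 * eisTrace (a 1) (a 4) + 2 * eisTrace (a 2) (a 2) + 4 * eisTrace (a 2) (a 3)
    + 4 * eisTrace (a 2) (a 4) + 3 * eisTrace (a 3) (a 3) + 4 * eisTrace (a 3) (a 4)
    + 4 * eisTrace (a 4) (a 4)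

/-- The autocorrelation of `a` at class `2`. -/
def quarticCorr₂ (a : Fin 5 → ℤ × ℤ) : ℤ :=
  2 * eisTrace (a 0) (a 2) + 4 * eisTrace (a 1) (a 1) + 4 * eisTrace (a 1) (a 2)
    + 4 * eisTrace (a 1) (a 3) + 4 * eisTrace (a 1) (a 4) + 8 * eisTrace (a 2) (a 3)
    + 6 * eisTrace (a 2) (a 4) + 2 * eisTrace (a 3) (a 3) + 4 * eisTrace (a 3) (a 4)
    + 3 * eisTrace (a 4) (a 4)

/-- The autocorrelation of `a` at class `3`. -/
def quarticCorr₃ (a : Fin 5 → ℤ × ℤ) : ℤ :=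
  2 * eisTrace (a 0) (a 3) + 3 * eisTrace (a 1) (a 1) + 4 * eisTrace (a 1) (a 2)
    + 6 * eisTrace (a 1) (a 3) + 4 * eisTrace (a 1) (a 4) + 4 * eisTrace (a 2) (a 2)
    + 4 * eisTrace (a 2) (a 3) + 4 * eisTrace (a 2) (a 4) + 8 * eisTrace (a 3) (a 4)
    + 2 * eisTrace (a 4) (a 4)

/-- The autocorrelation of `a` at class `4`. -/
def quarticCorr₄ (a : Fin 5 → ℤ × ℤ) : ℤ :=
  2 * eisTrace (a 0) (a 4) + 2 * eisTrace (a 1) (a 1) + 4 * eisTrace (a 1) (a 2)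
    + 4 * eisTrace (a 1) (a 3) + 8 * eisTrace (a 1) (a 4) + 3 * eisTrace (a 2) (a 2)
    + 4 * eisTrace (a 2) (a 3) + 6 * eisTrace (a 2) (a 4) + 4 * eisTrace (a 3) (a 3)
    + 4 * eisTrace (a 3) (a 4)

/-- The value at `0` of the correlation of `a` with its decimation by the square of a generator. -/
def twist₀ (a : Fin 5 → ℤ × ℤ) : ℤ :=
  eisRe (a 0) (a 0) + 10 * eisRe (a 1) (a 3) + 10 * eisRe (a 2) (a 4) + 10 * eisRe (a 3) (a 1)
    + 10 * eisRe (a 4) (a 2)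

/-- The value at class `1` of the correlation of `a` with its decimation by the square of a
generator. -/
def twist₁ (a : Fin 5 → ℤ × ℤ) : ℤ × ℤ :=
  (eisRe (a 0) (a 3) + eisRe (a 1) (a 0) + 4 * eisRe (a 1) (a 4) + 3 * eisRe (a 1) (a 1)
      + 2 * eisRe (a 1) (a 2) + 4 * eisRe (a 2) (a 3) + 2 * eisRe (a 2) (a 4)
      + 2 * eisRe (a 2) (a 1) + 2 * eisRe (a 2) (a 2) + 3 * eisRe (a 3) (a 3)
      + 2 * eisRe (a 3) (a 4) + 3 * eisRe (a 3) (a 1) + 2 * eisRe (a 3) (a 2)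
      + 2 * eisRe (a 4) (a 3) + 2 * eisRe (a 4) (a 4) + 2 * eisRe (a 4) (a 1)
      + 4 * eisRe (a 4) (a 2),
    eisIm (a 0) (a 3) + eisIm (a 1) (a 0) + 4 * eisIm (a 1) (a 4) + 3 * eisIm (a 1) (a 1)
      + 2 * eisIm (a 1) (a 2) + 4 * eisIm (a 2) (a 3) + 2 * eisIm (a 2) (a 4)
      + 2 * eisIm (a 2) (a 1) + 2 * eisIm (a 2) (a 2) + 3 * eisIm (a 3) (a 3)
      + 2 * eisIm (a 3) (a 4) + 3 * eisIm (a 3) (a 1) + 2 * eisIm (a 3) (a 2)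
      + 2 * eisIm (a 4) (a 3) + 2 * eisIm (a 4) (a 4) + 2 * eisIm (a 4) (a 1)
      + 4 * eisIm (a 4) (a 2))

/-- The value at class `2` of the correlation of `a` with its decimation by the square of a
generator. -/
def twist₂ (a : Fin 5 → ℤ × ℤ) : ℤ × ℤ :=
  (eisRe (a 0) (a 4) + 4 * eisRe (a 1) (a 3) + 2 * eisRe (a 1) (a 4) + 2 * eisRe (a 1) (a 1)
      + 2 * eisRe (a 1) (a 2) + eisRe (a 2) (a 0) + 2 * eisRe (a 2) (a 3) + 4 * eisRe (a 2) (a 1)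
      + 3 * eisRe (a 2) (a 2) + 2 * eisRe (a 3) (a 3) + 4 * eisRe (a 3) (a 4)
      + 2 * eisRe (a 3) (a 1) + 2 * eisRe (a 3) (a 2) + 2 * eisRe (a 4) (a 3)
      + 3 * eisRe (a 4) (a 4) + 2 * eisRe (a 4) (a 1) + 3 * eisRe (a 4) (a 2),
    eisIm (a 0) (a 4) + 4 * eisIm (a 1) (a 3) + 2 * eisIm (a 1) (a 4) + 2 * eisIm (a 1) (a 1)
      + 2 * eisIm (a 1) (a 2) + eisIm (a 2) (a 0) + 2 * eisIm (a 2) (a 3) + 4 * eisIm (a 2) (a 1)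
      + 3 * eisIm (a 2) (a 2) + 2 * eisIm (a 3) (a 3) + 4 * eisIm (a 3) (a 4)
      + 2 * eisIm (a 3) (a 1) + 2 * eisIm (a 3) (a 2) + 2 * eisIm (a 4) (a 3)
      + 3 * eisIm (a 4) (a 4) + 2 * eisIm (a 4) (a 1) + 3 * eisIm (a 4) (a 2))

/-! ### The 2-adic norm obstruction -/

/-- The twisted correlation is congruent modulo `64` to a norm of Eisenstein integers. -/
theorem exists_eisNorm_eq_twist (a : Fin 5 → ℤ × ℤ) : ∃ (b : ℤ × ℤ) (k : ℤ), eisNorm b =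
    twist₀ a - 26 * (twist₁ a).1 + 20 * (twist₁ a).2 + 25 * (twist₂ a).1
        + 3 * (twist₂ a).2 + 64 * k := by
  -- The quartic Gaussian periods modulo 64 are `6 - 26ω`, `-14 + 11ω` and their conjugates. As `2 ^
  -- 10 = -1` modulo 41, Frobenius at 2 moves classes by two steps and conjugates `ω`. The transform
  -- of the twisted correlation is thus the norm of `b`, the transform of `a`; the second witness is
  -- the quotient by 64.
  refine ⟨((a 0).1 + 6 * (a 1).1 + 26 * (a 1).2 + (-14) * (a 2).1 + (-11) * (a 2).2 + 32 * (a 3).1 +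
      (-26) * (a 3).2 + (-25) * (a 4).1 + 11 * (a 4).2,
    (a 0).2 + (-26) * (a 1).1 + 32 * (a 1).2 + 11 * (a 2).1 + (-25) * (a 2).2 + 26 * (a 3).1 + 6 *
        (a 3).2 + (-11) * (a 4).1 + (-14) * (a 4).2), (-1) * eisIm (a 0) (a 1) + 1 * eisRe (a 0)
        (a 1) + 1 * eisIm (a 0) (a 2)
      + (-1) * eisRe (a 0) (a 2) + 1 * eisRe (a 0) (a 3) + (-1) * eisRe (a 0) (a 4)
      + 14 * eisRe (a 1) (a 1) + 3 * eisIm (a 1) (a 2) + (-19) * eisRe (a 1) (a 2)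
      + 26 * eisIm (a 1) (a 3) + (-6) * eisRe (a 1) (a 3) + (-15) * eisIm (a 1) (a 4)
      + (-4) * eisRe (a 1) (a 4) + 7 * eisRe (a 2) (a 2) + (-15) * eisIm (a 2) (a 3)
      + (-4) * eisRe (a 2) (a 3) + 6 * eisIm (a 2) (a 4) + 10 * eisRe (a 2) (a 4)
      + 14 * eisRe (a 3) (a 3) + 16 * eisIm (a 3) (a 4) + (-19) * eisRe (a 3) (a 4)
      + 7 * eisRe (a 4) (a 4), ?_⟩
  simp only [eisNorm, twist₀, twist₁, twist₂, eisRe, eisIm]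
  ring

theorem eisNorm_not_two_mod_four (b : ℤ × ℤ) : eisNorm b % 4 ≠ 2 := by
  have h : ∀ x y : ZMod 4, x ^ 2 - x * y + y ^ 2 ≠ 2 := by decide
  intro hb
  refine h b.1 b.2 ?_
  have : ((eisNorm b : ℤ) : ZMod 4) = ((2 : ℤ) : ZMod 4) :=
      (ZMod.intCast_eq_intCast_iff' _ _ 4).2 hb
  simpa [eisNorm] using this

/-- The prime 2 is inert in the Eisenstein integers, so norms have even 2-adic valuation. -/
theorem eisNorm_not_thirtyTwo_mod (b : ℤ × ℤ) : eisNorm b % 64 ≠ 32 := by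
  have h : ∀ x y : ZMod 2, x ^ 2 - x * y + y ^ 2 = 0 → x = 0 ∧ y = 0 := by decide
  have half : ∀ b : ℤ × ℤ, eisNorm b % 2 = 0 → ∃ c, eisNorm b = 4 * eisNorm c := fun b hb => by
    have : ((eisNorm b : ℤ) : ZMod 2) = ((0 : ℤ) : ZMod 2) :=
      (ZMod.intCast_eq_intCast_iff' _ _ 2).2 hb
    obtain ⟨h1, h2⟩ := h b.1 b.2 (by simpa [eisNorm] using this)
    rw [ZMod.intCast_zmod_eq_zero_iff_dvd] at h1 h2
    obtain ⟨c, hc⟩ := h1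
    obtain ⟨d, hd⟩ := h2
    refine ⟨(c, d), ?_⟩
    simp only [eisNorm, hc, hd]
    push_cast
    ring
  intro hb
  obtain ⟨c, hc⟩ := half b (by omega)
  obtain ⟨d, hd⟩ := half c (by omega)
  exact eisNorm_not_two_mod_four d (by omega)

/-- The image of the twisted correlation in the integers modulo `64`. -/
def twistResidue (r₀ p₁ q₁ p₂ q₂ : ℤ) : ℤ := r₀ - 26 * p₁ + 20 * q₁ + 25 * p₂ + 3 * q₂

/-- A congruence condition that excludes norms of Eisenstein integers. -/
def IsNormObstruction (r : ℤ) : Prop := r % 64 = 32 ∨ r % 4 = 2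

theorem not_isNormObstruction_twistResidue (a : Fin 5 → ℤ × ℤ) :
    ¬ IsNormObstruction
      (twistResidue (twist₀ a) (twist₁ a).1 (twist₁ a).2 (twist₂ a).1 (twist₂ a).2) := by
  obtain ⟨b, k, h⟩ := exists_eisNorm_eq_twist a
  have h1 := eisNorm_not_thirtyTwo_mod b
  have h2 := eisNorm_not_two_mod_four b
  rw [IsNormObstruction, twistResidue]
  omega

/-- The rotation of an array that multiplies the argument by a generator. -/
def rotate (a : Fin 5 → ℤ × ℤ) : Fin 5 → ℤ × ℤ := ![a 0, a 2, a 3, a 4, a 1]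

/-- The twisted correlation takes conjugate values on opposite classes. Rotations thus give the four
Galois conjugates of the residue test. -/
theorem twist_rotate (a : Fin 5 → ℤ × ℤ) : twist₀ (rotate a) = twist₀ a ∧
    twist₁ (rotate a) = twist₂ a ∧
    twist₂ (rotate a) = ((twist₁ a).1 - (twist₁ a).2, -(twist₁ a).2) := by
  refine ⟨?_, Prod.ext ?_ ?_, Prod.ext ?_ ?_⟩ <;>
  simp only [rotate, twist₀, twist₁, twist₂, eisRe, eisIm, Matrix.cons_val] <;>
  ring

/-! ### The norm equation for the twisted correlation -/

/-- The rational part of (four times) the Fourier coefficient of the twisted correlation. -/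
def twistP (b : Fin 5 → ℤ × ℤ) : ℤ :=
  4 * twist₀ b - (2 * (twist₁ b).1 - (twist₁ b).2) - (2 * (twist₂ b).1 - (twist₂ b).2)

/-- The part of (four times) the Fourier coefficient of the twisted correlation along `√41`. -/
def twistQ (b : Fin 5 → ℤ × ℤ) : ℤ :=
  2 * (twist₁ b).1 - (twist₁ b).2 - (2 * (twist₂ b).1 - (twist₂ b).2)

/-- With `α, β` the differences of opposite periods, `α² = (41 - 5√41) / 2`, `β² = (41 + 5√41) / 2`
and `αβ = 2√41`. The left side is the rational part of `(P + Q√41)² + 12(q₁α + q₂β)²`, which is 16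
times the squared modulus of the transform. The companion identity compares the `√41` parts, halved.
-/
theorem twist_identity_rational {b : Fin 5 → ℤ × ℤ} (hb : b 4 = 0) :
    twistP b ^ 2 + 41 * twistQ b ^ 2 + 246 * ((twist₁ b).2 ^ 2 + (twist₂ b).2 ^ 2) =
      4 * quarticCorr₀ b * quarticCorr₀ b + (-2) * quarticCorr₀ b * quarticCorr₁ b
          + (-2) * quarticCorr₀ b * quarticCorr₂ b + (-2) * quarticCorr₀ b * quarticCorr₃ b
          + (-2) * quarticCorr₀ b * quarticCorr₄ b + (-10) * quarticCorr₁ b * quarticCorr₁ b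
          + (-20) * quarticCorr₁ b * quarticCorr₂ b + 62 * quarticCorr₁ b * quarticCorr₃ b
          + (-20) * quarticCorr₁ b * quarticCorr₄ b + (-10) * quarticCorr₂ b * quarticCorr₂ b
          + (-20) * quarticCorr₂ b * quarticCorr₃ b + 62 * quarticCorr₂ b * quarticCorr₄ b
          + (-10) * quarticCorr₃ b * quarticCorr₃ b + (-20) * quarticCorr₃ b * quarticCorr₄ b
          + (-10) * quarticCorr₄ b * quarticCorr₄ b := by
  simp only [twistP, twistQ, twist₀, twist₁, twist₂, eisRe, eisIm, eisTrace, quarticCorr₀,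
    quarticCorr₁, quarticCorr₂, quarticCorr₃, quarticCorr₄, hb, Prod.fst_zero, Prod.snd_zero,
        mul_zero, zero_mul, add_zero,
    zero_add, sub_zero]
  generalize (b 0).1 = x₀, (b 0).2 = y₀, (b 1).1 = x₁, (b 1).2 = y₁, (b 2).1 = x₂, (b 2).2 = y₂,
    (b 3).1 = x₃, (b 3).2 = y₃
  ring

theorem twist_identity_irrational {b : Fin 5 → ℤ × ℤ} (hb : b 4 = 0) :
    twistP b * twistQ b - 15 * ((twist₁ b).2 ^ 2 - (twist₂ b).2 ^ 2)
        + 24 * (twist₁ b).2 * (twist₂ b).2 =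
      1 * quarticCorr₀ b * quarticCorr₁ b + (-1) * quarticCorr₀ b * quarticCorr₂ b
          + 1 * quarticCorr₀ b * quarticCorr₃ b + (-1) * quarticCorr₀ b * quarticCorr₄ b
          + 1 * quarticCorr₁ b * quarticCorr₁ b + (-2) * quarticCorr₁ b * quarticCorr₂ b
          + (-3) * quarticCorr₁ b * quarticCorr₃ b + 2 * quarticCorr₁ b * quarticCorr₄ b
          + (-1) * quarticCorr₂ b * quarticCorr₂ b + 2 * quarticCorr₂ b * quarticCorr₃ b
          + 3 * quarticCorr₂ b * quarticCorr₄ b + 1 * quarticCorr₃ b * quarticCorr₃ b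
          + (-2) * quarticCorr₃ b * quarticCorr₄ b + (-1) * quarticCorr₄ b * quarticCorr₄ b := by
  simp only [twistP, twistQ, twist₀, twist₁, twist₂, eisRe, eisIm, eisTrace, quarticCorr₀,
    quarticCorr₁, quarticCorr₂, quarticCorr₃, quarticCorr₄, hb, Prod.fst_zero, Prod.snd_zero,
        mul_zero, zero_mul, add_zero,
    zero_add, sub_zero]
  generalize (b 0).1 = x₀, (b 0).2 = y₀, (b 1).1 = x₁, (b 1).2 = y₁, (b 2).1 = x₂, (b 2).2 = y₂,
    (b 3).1 = x₃, (b 3).2 = y₃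
  ring

/-- Subtracting a constant does not affect nontrivial Fourier coefficients. This permits the
normalisation `b 4 = 0`, which shortens the polynomial identities. -/
theorem twist_sub (a : Fin 5 → ℤ × ℤ) (c : ℤ × ℤ) :
    twistP (fun i => a i - c) = twistP a ∧ twistQ (fun i => a i - c) = twistQ a ∧
    (twist₁ fun i => a i - c).2 = (twist₁ a).2 ∧ (twist₂ fun i => a i - c).2 = (twist₂ a).2 := by
  refine ⟨?_, ?_, ?_, ?_⟩ <;>
  simp only [twistP, twistQ, twist₀, twist₁, twist₂, eisRe, eisIm, Prod.fst_sub, Prod.snd_sub] <;>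
  ring

theorem quarticCorr_sub (a : Fin 5 → ℤ × ℤ) (c : ℤ × ℤ) :
    (quarticCorr₀ fun i => a i - c) - (quarticCorr₄ fun i => a i - c)
      = quarticCorr₀ a - quarticCorr₄ a ∧
    (quarticCorr₁ fun i => a i - c) - (quarticCorr₄ fun i => a i - c)
      = quarticCorr₁ a - quarticCorr₄ a ∧
    (quarticCorr₂ fun i => a i - c) - (quarticCorr₄ fun i => a i - c)
      = quarticCorr₂ a - quarticCorr₄ a ∧
    (quarticCorr₃ fun i => a i - c) - (quarticCorr₄ fun i => a i - c)
      = quarticCorr₃ a - quarticCorr₄ a := by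
  refine ⟨?_, ?_, ?_, ?_⟩ <;>
  simp only [quarticCorr₀, quarticCorr₁, quarticCorr₂, quarticCorr₃, quarticCorr₄, eisTrace,
    Prod.fst_sub, Prod.snd_sub] <;>
  ring

/-- The autocorrelation equations for an array of Eisenstein integers on `ZMod 41` that depends
only on the cyclotomic class of order four, with peak value `3136`. -/
structure QuarticCorrelation (a : Fin 5 → ℤ × ℤ) : Prop where
  corr₀ : quarticCorr₀ a = 6272
  corr₁ : quarticCorr₁ a = 0
  corr₂ : quarticCorr₂ a = 0
  corr₃ : quarticCorr₃ a = 0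
  corr₄ : quarticCorr₄ a = 0

/-- The first equation comes from the trivial character; the other two are the components of `|4R|²
= 16 * 3136²`. -/
theorem QuarticCorrelation.twist_equations {a : Fin 5 → ℤ × ℤ} (h : QuarticCorrelation a) :
    twist₀ a + 10 * (4 * twist₀ a - twistP a) = 3136 ∧
    twistP a ^ 2 + 41 * twistQ a ^ 2 + 246 * ((twist₁ a).2 ^ 2 + (twist₂ a).2 ^ 2)
      = 4 * 6272 ^ 2 ∧
    twistP a * twistQ a - 15 * ((twist₁ a).2 ^ 2 - (twist₂ a).2 ^ 2)
      + 24 * (twist₁ a).2 * (twist₂ a).2 = 0 := by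
  obtain ⟨h0, h1, h2, h3, h4⟩ := h
  obtain ⟨t1, t2, t3, t4⟩ := twist_sub a (a 4)
  obtain ⟨c0, c1, c2, c3⟩ := quarticCorr_sub a (a 4)
  have e1 := twist_identity_rational (b := fun i => a i - a 4) (sub_self _)
  have e2 := twist_identity_irrational (b := fun i => a i - a 4) (sub_self _)
  rw [t1, t2, t3, t4] at e1 e2
  rw [h4, sub_zero, sub_eq_iff_eq_add] at c0 c1 c2 c3
  rw [h0] at c0
  rw [h1] at c1
  rw [h2] at c2
  rw [h3] at c3
  refine ⟨?_, ?_, ?_⟩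
  · have : 2 * (twist₀ a + 10 * (4 * twist₀ a - twistP a)) = quarticCorr₀ a
        + 10 * (quarticCorr₁ a + quarticCorr₂ a + quarticCorr₃ a + quarticCorr₄ a) := by
      simp only [twistP, twist₀, twist₁, twist₂, eisRe, eisIm, eisTrace, quarticCorr₀,
        quarticCorr₁, quarticCorr₂, quarticCorr₃, quarticCorr₄]
      ring
    omega
  · rw [e1, c0, c1, c2, c3]
    ring
  · rw [e2, c0, c1, c2, c3]
    ring

/-- The prime 7 is inert in the cyclic quartic field containing the twisted coefficient, so its
relative norm to `ℚ(√41)` is anisotropic modulo 7. -/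
theorem norm_form_anisotropic_seven {P Q q₁ q₂ : ℤ}
    (h1 : (7 : ℤ) ∣ P ^ 2 + 41 * Q ^ 2 + 246 * (q₁ ^ 2 + q₂ ^ 2))
    (h2 : P * Q - 15 * (q₁ ^ 2 - q₂ ^ 2) + 24 * q₁ * q₂ = 0) :
    7 ∣ P ∧ 7 ∣ Q ∧ 7 ∣ q₁ ∧ 7 ∣ q₂ := by
  have key : ∀ P Q q₁ q₂ : ZMod 7, P ^ 2 + 41 * Q ^ 2 + 246 * (q₁ ^ 2 + q₂ ^ 2) = 0 →
      P * Q - 15 * (q₁ ^ 2 - q₂ ^ 2) + 24 * q₁ * q₂ = 0 → P = 0 ∧ Q = 0 ∧ q₁ = 0 ∧ q₂ = 0 := by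
    decide +kernel
  have h1' := (ZMod.intCast_zmod_eq_zero_iff_dvd _ 7).2 h1
  have h2' : ((P * Q - 15 * (q₁ ^ 2 - q₂ ^ 2) + 24 * q₁ * q₂ : ℤ) : ZMod 7) = 0 := by
    rw [h2, Int.cast_zero]
  push_cast at h1' h2'
  obtain ⟨a, b, c, d⟩ := key _ _ _ _ h1' h2'
  exact ⟨(ZMod.intCast_zmod_eq_zero_iff_dvd _ 7).1 a, (ZMod.intCast_zmod_eq_zero_iff_dvd _ 7).1 b,
    (ZMod.intCast_zmod_eq_zero_iff_dvd _ 7).1 c, (ZMod.intCast_zmod_eq_zero_iff_dvd _ 7).1 d⟩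

theorem norm_form_descent_seven {P Q q₁ q₂ M : ℤ}
    (h1 : P ^ 2 + 41 * Q ^ 2 + 246 * (q₁ ^ 2 + q₂ ^ 2) = 49 * M)
    (h2 : P * Q - 15 * (q₁ ^ 2 - q₂ ^ 2) + 24 * q₁ * q₂ = 0) :
    ∃ P' Q' r₁ r₂ : ℤ, P = 7 * P' ∧ Q = 7 * Q' ∧ q₁ = 7 * r₁ ∧ q₂ = 7 * r₂ ∧
      P' ^ 2 + 41 * Q' ^ 2 + 246 * (r₁ ^ 2 + r₂ ^ 2) = M ∧
      P' * Q' - 15 * (r₁ ^ 2 - r₂ ^ 2) + 24 * r₁ * r₂ = 0 := by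
  obtain ⟨⟨P', rfl⟩, ⟨Q', rfl⟩, ⟨r₁, rfl⟩, ⟨r₂, rfl⟩⟩ :=
    norm_form_anisotropic_seven (h1 ▸ ⟨7 * M, by ring⟩) h2
  exact ⟨P', Q', r₁, r₂, rfl, rfl, rfl, rfl, by linarith, by linarith⟩

/-- Here `k = |Q|`; `P` is eliminated by squaring the second equation, and terms are moved across to
avoid natural subtraction. -/
theorem norm_form_search : ∀ i ∈ List.range 17, ∀ j ∈ List.range 17, ∀ k ∈ List.range 40,
    (15 * i * i) ^ 2 + (15 * j * j + 24 * i * j) ^ 2 + k * k * (41 * k * k + 246 * (i * i + j * j))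
      = 65536 * k * k + 2 * (15 * i * i) * (15 * j * j + 24 * i * j) →
    i = 0 ∧ j = 0 ∨ k = 12 ∧ i = 12 ∧ j = 8 ∨ k = 30 ∧ i = 10 ∧ j = 4 := by
  decide +kernel

theorem norm_form_solutions_of_nonneg {P Q q₁ q₂ : ℤ} (hq₁ : 0 ≤ q₁) (hq₂ : 0 ≤ q₂)
    (h1 : P ^ 2 + 41 * Q ^ 2 + 246 * (q₁ ^ 2 + q₂ ^ 2) = 65536)
    (h2 : P * Q - 15 * (q₁ ^ 2 - q₂ ^ 2) + 24 * q₁ * q₂ = 0) :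
    q₁ = 0 ∧ q₂ = 0 ∨ |Q| = 12 ∧ q₁ = 12 ∧ q₂ = 8 ∨ |Q| = 30 ∧ q₁ = 10 ∧ q₂ = 4 := by
  have hb₁ : q₁ < 17 := by nlinarith
  have hb₂ : q₂ < 17 := by nlinarith
  have hQ : |Q| < 40 := by rw [abs_lt]; constructor <;> nlinarith
  have e := abs_mul_abs_self Q
  have h0 := abs_nonneg Q
  have hL : 15 * (q₁ ^ 2 - q₂ ^ 2) - 24 * q₁ * q₂ = P * Q := by linarith
  have key : (P * Q) ^ 2 = (65536 - 41 * Q ^ 2 - 246 * (q₁ ^ 2 + q₂ ^ 2)) * (|Q| * |Q|) := by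
    rw [e, mul_pow, ← h1]
    ring
  rw [← hL, sq Q, ← e] at key
  clear hL h1 h2 e
  generalize |Q| = K at *
  lift q₁ to ℕ using hq₁
  lift q₂ to ℕ using hq₂
  lift K to ℕ using h0
  have := norm_form_search q₁ (List.mem_range.2 (by omega)) q₂ (List.mem_range.2 (by omega)) K
    (List.mem_range.2 (by omega)) (by zify; linarith)
  omega

theorem norm_form_solutions {P Q q₁ q₂ : ℤ}
    (h1 : P ^ 2 + 41 * Q ^ 2 + 246 * (q₁ ^ 2 + q₂ ^ 2) = 65536)
    (h2 : P * Q - 15 * (q₁ ^ 2 - q₂ ^ 2) + 24 * q₁ * q₂ = 0) :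
    (q₁ = 0 ∧ q₂ = 0) ∨
    (|Q| = 12 ∧ (q₁ = 12 ∧ q₂ = 8 ∨ q₁ = -12 ∧ q₂ = -8 ∨ q₁ = 8 ∧ q₂ = -12 ∨
      q₁ = -8 ∧ q₂ = 12)) ∨
    (|Q| = 30 ∧ (q₁ = 10 ∧ q₂ = 4 ∨ q₁ = -10 ∧ q₂ = -4 ∨ q₁ = 4 ∧ q₂ = -10 ∨
      q₁ = -4 ∧ q₂ = 10)) := by
  rcases le_total 0 q₁ with ha | ha <;> rcases le_total 0 q₂ with hb | hb
  · have := norm_form_solutions_of_nonneg ha hb h1 h2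
    clear h1 h2
    rcases this with ⟨a, b⟩ | ⟨hQ, a, b⟩ | ⟨hQ, a, b⟩
    · exact Or.inl ⟨by omega, by omega⟩
    · exact Or.inr (Or.inl ⟨hQ, by omega⟩)
    · exact Or.inr (Or.inr ⟨hQ, by omega⟩)
  -- The quarter turn of `(q₁, q₂)` combined with `P ↦ -P` preserves both equations.
  · have := norm_form_solutions_of_nonneg (P := -P) (Q := Q) (neg_nonneg.2 hb) ha
      (by linarith) (by linarith)
    clear h1 h2
    rcases this with ⟨a, b⟩ | ⟨hQ, a, b⟩ | ⟨hQ, a, b⟩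
    · exact Or.inl ⟨by omega, by omega⟩
    · exact Or.inr (Or.inl ⟨hQ, by omega⟩)
    · exact Or.inr (Or.inr ⟨hQ, by omega⟩)
  · have := norm_form_solutions_of_nonneg (P := -P) (Q := Q) hb (neg_nonneg.2 ha)
      (by linarith) (by linarith)
    clear h1 h2
    rcases this with ⟨a, b⟩ | ⟨hQ, a, b⟩ | ⟨hQ, a, b⟩
    · exact Or.inl ⟨by omega, by omega⟩
    · exact Or.inr (Or.inl ⟨hQ, by omega⟩)
    · exact Or.inr (Or.inr ⟨hQ, by omega⟩)
  · have := norm_form_solutions_of_nonneg (neg_nonneg.2 ha) (neg_nonneg.2 hb) (P := P) (Q := Q)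
      (by linarith) (by linarith)
    clear h1 h2
    rcases this with ⟨a, b⟩ | ⟨hQ, a, b⟩ | ⟨hQ, a, b⟩
    · exact Or.inl ⟨by omega, by omega⟩
    · exact Or.inr (Or.inl ⟨hQ, by omega⟩)
    · exact Or.inr (Or.inr ⟨hQ, by omega⟩)

theorem twist_coordinates {P Q q₁ q₂ r₀ p₁ p₂ : ℤ}
    (h0 : r₀ + 10 * (4 * r₀ - 49 * P) = 3136)
    (hP : 49 * P = 4 * r₀ - (2 * p₁ - 49 * q₁) - (2 * p₂ - 49 * q₂))
    (hQ : 49 * Q = 2 * p₁ - 49 * q₁ - (2 * p₂ - 49 * q₂)) :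
    41 * r₀ = 3136 + 490 * P ∧ 4 * p₁ = 4 * r₀ - 49 * P + 49 * Q + 98 * q₁ ∧
      4 * p₂ = 4 * r₀ - 49 * P - 49 * Q + 98 * q₂ := by
  refine ⟨?_, ?_, ?_⟩ <;> linarith

/-- Each solution has `P = ±92` or `P = ±10`. The negative values make `r₀` nonintegral modulo 41;
for the positive ones some conjugate has a residue that is not a norm. -/
theorem isNormObstruction_of_solution {P Q q₁ q₂ r₀ p₁ p₂ : ℤ}
    (h0 : 41 * r₀ = 3136 + 490 * P) (h1 : 4 * p₁ = 4 * r₀ - 49 * P + 49 * Q + 98 * q₁)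
    (h3 : 4 * p₂ = 4 * r₀ - 49 * P - 49 * Q + 98 * q₂)
    (h2 : P * Q - 15 * (q₁ ^ 2 - q₂ ^ 2) + 24 * q₁ * q₂ = 0)
    (h : (|Q| = 12 ∧ (q₁ = 12 ∧ q₂ = 8 ∨ q₁ = -12 ∧ q₂ = -8 ∨ q₁ = 8 ∧ q₂ = -12 ∨
        q₁ = -8 ∧ q₂ = 12)) ∨
      (|Q| = 30 ∧ (q₁ = 10 ∧ q₂ = 4 ∨ q₁ = -10 ∧ q₂ = -4 ∨ q₁ = 4 ∧ q₂ = -10 ∨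
        q₁ = -4 ∧ q₂ = 10))) :
    IsNormObstruction (twistResidue r₀ p₁ (49 * q₁) p₂ (49 * q₂)) ∨
    IsNormObstruction (twistResidue r₀ p₂ (49 * q₂) (p₁ - 49 * q₁) (-(49 * q₁))) ∨
    IsNormObstruction (twistResidue r₀ (p₁ - 49 * q₁) (-(49 * q₁)) (p₂ - 49 * q₂) (-(49 * q₂))) ∨
    IsNormObstruction (twistResidue r₀ (p₂ - 49 * q₂) (-(49 * q₂)) p₁ (49 * q₁)) := by
  have cases : ∀ P' r p p' : ℤ, P = P' → 41 * r = 3136 + 490 * P' →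
      4 * p = 4 * r - 49 * P' + 49 * Q + 98 * q₁ → 4 * p' = 4 * r - 49 * P' - 49 * Q + 98 * q₂ →
      r₀ = r ∧ p₁ = p ∧ p₂ = p' := by
    rintro P' r p p' rfl e1 e2 e3
    refine ⟨?_, ?_, ?_⟩ <;> linarith
  simp only [IsNormObstruction, twistResidue]
  rw [abs_eq (by norm_num), abs_eq (by norm_num)] at h
  rcases h with ⟨rfl | rfl, ⟨rfl, rfl⟩ | ⟨rfl, rfl⟩ | ⟨rfl, rfl⟩ | ⟨rfl, rfl⟩⟩ |
    ⟨rfl | rfl, ⟨rfl, rfl⟩ | ⟨rfl, rfl⟩ | ⟨rfl, rfl⟩ | ⟨rfl, rfl⟩⟩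
  · obtain rfl : P = -92 := by linarith
    clear h1 h2 h3 cases
    omega
  · obtain rfl : P = -92 := by linarith
    clear h1 h2 h3 cases
    omega
  · obtain ⟨rfl, rfl, rfl⟩ := cases 92 1176 392 (-392) (by linarith) (by norm_num) (by norm_num)
      (by norm_num)
    decide
  · obtain ⟨rfl, rfl, rfl⟩ := cases 92 1176 0 196 (by linarith) (by norm_num) (by norm_num)
      (by norm_num)
    decide
  · obtain ⟨rfl, rfl, rfl⟩ := cases 92 1176 196 392 (by linarith) (by norm_num) (by norm_num)
      (by norm_num)
    decide
  · obtain ⟨rfl, rfl, rfl⟩ := cases 92 1176 (-392) 0 (by linarith) (by norm_num) (by norm_num)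
      (by norm_num)
    decide
  · obtain rfl : P = -92 := by linarith
    clear h1 h2 h3 cases
    omega
  · obtain rfl : P = -92 := by linarith
    clear h1 h2 h3 cases
    omega
  · obtain ⟨rfl, rfl, rfl⟩ := cases 10 196 686 (-196) (by linarith) (by norm_num) (by norm_num)
      (by norm_num)
    decide
  · obtain ⟨rfl, rfl, rfl⟩ := cases 10 196 196 (-392) (by linarith) (by norm_num) (by norm_num)
      (by norm_num)
    decide
  · obtain rfl : P = -10 := by linarith
    clear h1 h2 h3 cases
    omega
  · obtain rfl : P = -10 := by linarith
    clear h1 h2 h3 cases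
    omega
  · obtain rfl : P = -10 := by linarith
    clear h1 h2 h3 cases
    omega
  · obtain rfl : P = -10 := by linarith
    clear h1 h2 h3 cases
    omega
  · obtain ⟨rfl, rfl, rfl⟩ := cases 10 196 (-196) 196 (by linarith) (by norm_num) (by norm_num)
      (by norm_num)
    decide
  · obtain ⟨rfl, rfl, rfl⟩ := cases 10 196 (-392) 686 (by linarith) (by norm_num) (by norm_num)
      (by norm_num)
    decide
theorem QuarticCorrelation.twist_eq {a : Fin 5 → ℤ × ℤ} (h : QuarticCorrelation a) :
    twist₀ a = 3136 := by
  obtain ⟨h0, h1, h2⟩ := h.twist_equations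
  have hP : twistP a = 4 * twist₀ a - (2 * (twist₁ a).1 - (twist₁ a).2)
    - (2 * (twist₂ a).1 - (twist₂ a).2) := rfl
  have hQ : twistQ a = 2 * (twist₁ a).1 - (twist₁ a).2 - (2 * (twist₂ a).1 - (twist₂ a).2) := rfl
  have m0 := not_isNormObstruction_twistResidue a
  have m1 := not_isNormObstruction_twistResidue (rotate a)
  have m2 := not_isNormObstruction_twistResidue (rotate (rotate a))
  have m3 := not_isNormObstruction_twistResidue (rotate (rotate (rotate a)))
  simp only [twist_rotate, sub_neg_eq_add, sub_add_cancel, neg_neg] at m1 m2 m3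
  generalize twist₀ a = r₀, (twist₁ a).1 = p₁, (twist₁ a).2 = q₁, (twist₂ a).1 = p₂,
    (twist₂ a).2 = q₂, twistP a = P, twistQ a = Q at *
  -- Two descents apply because `4 * 6272 ^ 2 = 7 ^ 4 * 65536`.
  obtain ⟨P, Q, q₁, q₂, rfl, rfl, rfl, rfl, k1, k2⟩ :=
    norm_form_descent_seven (M := 16 * 448 ^ 2) (by rw [h1]; norm_num) h2
  obtain ⟨P, Q, q₁, q₂, rfl, rfl, rfl, rfl, l1, l2⟩ :=
    norm_form_descent_seven (M := 65536) (by rw [k1]; norm_num) k2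
  clear h1 h2 k1 k2
  have e : ∀ x : ℤ, 7 * (7 * x) = 49 * x := fun x => by ring
  simp only [e] at *
  obtain ⟨c0, c1, c2⟩ := twist_coordinates h0 hP hQ
  rcases norm_form_solutions l1 l2 with ⟨rfl, rfl⟩ | h
  · clear m0 m1 m2 m3 h0 hP hQ c1 c2 h
    -- Divisibility by 41 in `c0` rejects `P = 0` and `P = -256`; `P = 256` gives the claimed value.
    have hPQ : P = 0 ∨ Q = 0 := by simpa using l2
    rcases hPQ with rfl | rfl
    · clear l1 l2
      omega
    have : P = 256 ∨ P = -256 := by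
      rw [← sq_eq_sq_iff_eq_or_eq_neg]
      linarith
    clear l1 l2
    omega
  · have := isNormObstruction_of_solution c0 c1 c2 l2 h
    tauto

/-! ### Arrays constant on quadratic classes -/

theorem eisNorm_nonneg (a : ℤ × ℤ) : 0 ≤ eisNorm a := by
  simp only [eisNorm]
  nlinarith [sq_nonneg (a.1 - a.2), sq_nonneg a.1, sq_nonneg a.2]

theorem eq_of_eisNorm_sub {a b : ℤ × ℤ} (h : eisNorm (a - b) ≤ 0) : a = b := by
  simp only [eisNorm, Prod.fst_sub, Prod.snd_sub] at h
  have h1 : a.1 - b.1 = 0 := by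
    nlinarith [sq_nonneg (a.1 - b.1 - 2 * (a.2 - b.2)), sq_nonneg (a.1 - b.1)]
  have h2 : a.2 - b.2 = 0 := by
    nlinarith [sq_nonneg (a.2 - b.2 - 2 * (a.1 - b.1)), sq_nonneg (a.2 - b.2)]
  exact Prod.ext (by linarith) (by linarith)

/-- The digit-by-digit integer square root of a number below `2 ^ 24`. -/
def binarySqrt (x : ℕ) : ℕ :=
  [2048, 1024, 512, 256, 128, 64, 32, 16, 8, 4, 2, 1].foldl
    (fun r b => if (r + b) * (r + b) ≤ x then r + b else r) 0

/-- Traps each value strictly between consecutive numbers `3r²`. The index is shifted by one, as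
`12503 = 12544 - 41`. -/
theorem quadratic_search : (List.range 305).all (fun n =>
    (fun t r => decide (3 * r ^ 2 < t ∧ t < 3 * (r + 1) ^ 2)) (4 * (n + 1) * (12503 - 41 * n))
      (binarySqrt (4 * (n + 1) * (12503 - 41 * n) / 3))) = true := by
  decide +kernel

theorem exists_sq_lt_lt {n : ℕ} (h : n < 305) : ∃ r : ℕ,
    3 * r ^ 2 < 4 * (n + 1) * (12503 - 41 * n) ∧
      4 * (n + 1) * (12503 - 41 * n) < 3 * (r + 1) ^ 2 :=
  ⟨_, of_decide_eq_true (List.all_eq_true.1 quadratic_search n (List.mem_range.2 h))⟩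

theorem quadratic_solution {n k : ℤ} (h0 : 0 ≤ n) (h1 : n ≤ 305)
    (h : 4 * n * (12544 - 41 * n) = 3 * k ^ 2) : n = 0 := by
  by_contra hn
  obtain ⟨m, rfl⟩ : ∃ m : ℕ, n = m + 1 := ⟨(n - 1).toNat, by omega⟩
  have hm : m < 305 := by omega
  obtain ⟨r, l, hl⟩ := exists_sq_lt_lt hm
  have hle : 41 * m ≤ 12503 := by omega
  zify [hle] at l hl
  have e : 4 * ((m : ℤ) + 1) * (12503 - 41 * m) = 3 * k ^ 2 := by rw [← h]; ring
  rw [e] at l hl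
  have a1 : (r : ℤ) < |k| := by
    refine lt_of_pow_lt_pow_left₀ 2 (abs_nonneg k) ?_
    rw [sq_abs]; linarith
  have a2 : |k| < r + 1 := by
    refine lt_of_pow_lt_pow_left₀ 2 (by omega : (0 : ℤ) ≤ r + 1) ?_
    rw [sq_abs]; linarith
  omega

/-- There is no array of Eisenstein integers with these autocorrelations whose entry at `0` has
norm at most `1156`. -/
theorem QuarticCorrelation.false {a : Fin 5 → ℤ × ℤ} (h : QuarticCorrelation a)
    (hb : eisNorm (a 0) ≤ 1156) : False := by
  have ht := h.twist_eq
  have h0 := h.corr₀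
  have e13 : a 1 = a 3 ∧ a 2 = a 4 := by
    -- Equality in Cauchy–Schwarz between the array and its decimation.
    have key : 20 * (eisNorm (a 1 - a 3) + eisNorm (a 2 - a 4)) = quarticCorr₀ a - 2 * twist₀ a :=
        by
      simp only [eisNorm, quarticCorr₀, twist₀, eisTrace, eisRe, Prod.fst_sub, Prod.snd_sub]
      ring
    have n1 := eisNorm_nonneg (a 1 - a 3)
    have n2 := eisNorm_nonneg (a 2 - a 4)
    exact ⟨eq_of_eisNorm_sub (by linarith), eq_of_eisNorm_sub (by linarith)⟩
  obtain ⟨e1, e2⟩ := e13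
  have h1 := h.corr₁
  have h2 := h.corr₂
  simp only [quarticCorr₀, quarticCorr₁, quarticCorr₂, ← e1, ← e2] at h0 h1 h2
  clear h ht e1 e2
  generalize a 0 = u, a 1 = v, a 2 = w at *
  -- Twice a Fourier coefficient is now `(2u - v - w) + (v - w)√41`, of squared modulus `4 * 3136`;
  -- the rational and `√41` parts are compared.
  have hn : eisNorm (u + u - v - w) + 41 * eisNorm (v - w) = 12544 := by
    simp only [eisNorm, eisTrace, Prod.fst_sub, Prod.snd_sub, Prod.fst_add, Prod.snd_add] at *
    linarith
  have htr : eisTrace (u + u - v - w) (v - w) = 0 := by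
    simp only [eisTrace, Prod.fst_sub, Prod.snd_sub, Prod.fst_add, Prod.snd_add] at *
    linarith
  have hid : ∀ x y : ℤ × ℤ, 4 * eisNorm y * eisNorm x = eisTrace x y ^ 2 + 3 * eisIm x y ^ 2 :=
    fun x y => by simp only [eisNorm, eisTrace, eisIm]; ring
  have hz : eisNorm (v - w) = 0 := by
    have n1 := eisNorm_nonneg (u + u - v - w)
    refine quadratic_solution (k := eisIm (u + u - v - w) (v - w)) (eisNorm_nonneg _) (by omega) ?_
    rw [← hn, add_sub_cancel_right, hid, htr]
    ring
  obtain rfl := eq_of_eisNorm_sub hz.le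
  have hN : eisNorm u + 40 * eisNorm v = 3136 := by
    simp only [eisNorm, eisTrace] at *
    linarith
  have hT : eisTrace u v = -39 * eisNorm v := by
    simp only [eisNorm, eisTrace] at *
    linarith
  have hc := hid u v
  rw [hT] at hc
  have n1 := eisNorm_nonneg v
  -- For `n = eisNorm v`, the bound on `u` gives `n > 49`, while `4n(3136 - 40n) ≥ 1521n²` allows
  -- only `n ≤ 7`.
  nlinarith [sq_nonneg (eisIm u v)]

/-! ### Cyclotomic numbers of order four -/

/-- A representative of a cyclotomic class of order four. -/
def quarticRep : Fin 5 → ZMod 41 := ![0, 1, 6, 36, 11]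

theorem exists_pow_four_mul_quarticRep :
    ∀ z : ZMod 41, ∃ k : Fin 10, z = 4 ^ (k : ℕ) * quarticRep (quarticClass z) := by
  decide +kernel

theorem apply_quarticRep {α : Type*} {x : ZMod 41 → α} (hx : ∀ z, x (4 * z) = x z) (z : ZMod 41) :
    x (quarticRep (quarticClass z)) = x z := by
  have : ∀ (k : ℕ) (z : ZMod 41), x (4 ^ k * z) = x z := fun k => by
    induction k with
    | zero => simp
    | succ k ih => intro z; rw [pow_succ, mul_assoc, ih, hx]
  obtain ⟨k, hk⟩ := exists_pow_four_mul_quarticRep z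
  conv_rhs => rw [hk, this]

theorem sum_quarticClass (F : Fin 5 → Fin 5 → ℤ) (s : ZMod 41) :
    ∑ z, F (quarticClass z) (quarticClass (z + s)) = ∑ i, ∑ j,
      (Finset.univ.filter fun z => quarticClass z = i ∧ quarticClass (z + s) = j).card * F i j := by
  rw [← Fintype.sum_prod_type'
    (f := fun i j => ((Finset.univ.filter fun z =>
      quarticClass z = i ∧ quarticClass (z + s) = j).card : ℤ) * F i j),
    ← Finset.sum_fiberwise Finset.univ fun z => (quarticClass z, quarticClass (z + s))]
  refine Finset.sum_congr rfl fun p _ => ?_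
  rw [← nsmul_eq_mul]
  simp only [Prod.ext_iff]
  refine Finset.sum_eq_card_nsmul fun z hz => ?_
  rw [(Finset.mem_filter.1 hz).2.1, (Finset.mem_filter.1 hz).2.2]

/-- The numbers of solutions of `z ∈ Cᵢ`, `z + s ∈ Cⱼ` for `s` a representative of a class. -/
def cyclotomicNumber : Fin 5 → Fin 5 → Fin 5 → ℕ :=
  ![![![1, 0, 0, 0, 0], ![0, 10, 0, 0, 0], ![0, 0, 10, 0, 0], ![0, 0, 0, 10, 0], ![0, 0, 0, 0, 10]],
    ![![0, 1, 0, 0, 0], ![1, 0, 4, 3, 2], ![0, 4, 2, 2, 2], ![0, 3, 2, 3, 2], ![0, 2, 2, 2, 4]],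
    ![![0, 0, 1, 0, 0], ![0, 4, 2, 2, 2], ![1, 2, 0, 4, 3], ![0, 2, 4, 2, 2], ![0, 2, 3, 2, 3]],
    ![![0, 0, 0, 1, 0], ![0, 3, 2, 3, 2], ![0, 2, 4, 2, 2], ![1, 3, 2, 0, 4], ![0, 2, 2, 4, 2]],
    ![![0, 0, 0, 0, 1], ![0, 2, 2, 2, 4], ![0, 2, 3, 2, 3], ![0, 2, 2, 4, 2], ![1, 4, 3, 2, 0]]]

theorem card_cyclotomic : ∀ s i j : Fin 5, (Finset.univ.filter fun z =>
    quarticClass z = i ∧ quarticClass (z + quarticRep s) = j).card = cyclotomicNumber s i j := by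
  decide +kernel

/-- Pairs are counted by cyclotomic numbers. Since `-1 = 4 ^ 5` modulo 41, the array is even and its
autocorrelations are real, so traces lose nothing. -/
theorem quarticCorrelation_of_sum {x : ZMod 41 → ℤ × ℤ} (hx : ∀ z, x (4 * z) = x z)
    (h : ∀ s, ∑ z, eisTrace (x z) (x (z + s)) = if s = 0 then 6272 else 0) :
    QuarticCorrelation fun i => x (quarticRep i) := by
  have key : ∀ s : Fin 5, ∑ i, ∑ j, (cyclotomicNumber s i j : ℤ)
      * eisTrace (x (quarticRep i)) (x (quarticRep j))
      = if quarticRep s = 0 then 6272 else 0 := fun s => by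
    rw [← h]
    simp only [← card_cyclotomic]
    rw [← sum_quarticClass fun i j => eisTrace (x (quarticRep i)) (x (quarticRep j))]
    simp only [apply_quarticRep hx]
  have comm : ∀ a b, eisTrace a b = eisTrace b a := fun a b => by simp only [eisTrace]; ring
  have k0 := key 0
  have k1 := key 1
  have k2 := key 2
  have k3 := key 3
  have k4 := key 4
  rw [if_pos (by decide)] at k0
  rw [if_neg (by decide)] at k1 k2 k3 k4
  simp only [Fin.sum_univ_five, cyclotomicNumber, Matrix.cons_val] at k0 k1 k2 k3 k4
  generalize hX : (fun i => x (quarticRep i)) = X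
  have hX' : ∀ i, x (quarticRep i) = X i := fun i => by rw [← hX]
  simp only [hX'] at k0 k1 k2 k3 k4
  rw [comm (X 1) (X 0), comm (X 2) (X 0), comm (X 3) (X 0), comm (X 4) (X 0), comm (X 2) (X 1),
    comm (X 3) (X 1), comm (X 4) (X 1), comm (X 3) (X 2), comm (X 4) (X 2), comm (X 4) (X 3)]
    at k0 k1 k2 k3 k4
  constructor
  · rw [← k0, quarticCorr₀]; push_cast; ring
  · rw [← k1, quarticCorr₁]; push_cast; ring
  · rw [← k2, quarticCorr₂]; push_cast; ring
  · rw [← k3, quarticCorr₃]; push_cast; ring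
  · rw [← k4, quarticCorr₄]; push_cast; ring

/-! ### From `ZMod 369` to Eisenstein arrays on `ZMod 41` -/

theorem IsPerfectArray.translate {w : ℕ} [NeZero w] {X : ZMod w → ℤ} {N : ℕ}
    (hX : IsPerfectArray X N) (c : ZMod w) : IsPerfectArray (fun z => X (z + c)) N := fun s => by
  rw [← hX s, ← Equiv.sum_comp (Equiv.addRight c) fun z => X z * X (z + s)]
  simp only [Equiv.coe_addRight, add_right_comm _ s c]

/-- The embedding of `ZMod 3` into `ZMod 369`. -/
def embThree (i : ZMod 3) : ZMod 369 := 123 * (i.val : ZMod 369)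

/-- The embedding of `ZMod 41` into `ZMod 369`. -/
def embFortyOne (y : ZMod 41) : ZMod 369 := 9 * (y.val : ZMod 369)

theorem embThree_add : ∀ i j, embThree (i + j) = embThree i + embThree j := by
  decide +kernel

theorem embFortyOne_add : ∀ y s, embFortyOne (y + s) = embFortyOne y + embFortyOne s := by
  decide +kernel

theorem embFortyOne_four_mul : ∀ y, embFortyOne (4 * y) = 4 * embFortyOne y := by
  decide +kernel

theorem four_mul_embThree : ∀ i, 4 * embThree i = embThree i := by
  decide +kernel

theorem emb_eq_zero_iff : ∀ i y, embThree i + embFortyOne y = 0 ↔ i = 0 ∧ y = 0 := by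
  decide +kernel

/-- The coordinates on `ZMod 369` given by the cosets of its subgroup of order `123`. -/
def gridPoint (p : Fin 3 × ZMod 3 × ZMod 41) : ZMod 369 :=
  embThree p.2.1 + embFortyOne p.2.2 + (p.1 : ℕ)

/-- For `q = z.val / 3` the coordinates solve `41i + 3y = q` modulo 123: 2 inverts 41 modulo 3, and
14 inverts 3 modulo 41. -/
theorem exists_gridPoint : ∀ z : ZMod 369, gridPoint
    (⟨z.val % 3, Nat.mod_lt _ (by norm_num)⟩, (2 * (z.val / 3) : ℕ), (14 * (z.val / 3) : ℕ)) = z :=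
        by
  decide +kernel

theorem gridPoint_bijective : Function.Bijective gridPoint :=
  (Fintype.bijective_iff_surjective_and_card _).2
    ⟨fun z => ⟨_, exists_gridPoint z⟩, by simp [ZMod.card]⟩

theorem gridPoint_one_mul : ∀ i y, 124 * gridPoint (1, i, y) = gridPoint (1, i + 1, y) := by
  decide +kernel

theorem gridPoint_two_mul : ∀ i y, 247 * gridPoint (2, i, y) = gridPoint (2, i + 1, y) := by
  decide +kernel

theorem gridPoint_add (r : Fin 3) (i j : ZMod 3) (y s : ZMod 41) :
    gridPoint (r, i, y) + (embThree j + embFortyOne s) = gridPoint (r, i + j, y + s) := by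
  simp only [gridPoint, embThree_add, embFortyOne_add]
  ring

theorem sum_gridPoint (V : ZMod 369 → ℤ) (j : ZMod 3) (s : ZMod 41) :
    ∑ z, V z * V (z + (embThree j + embFortyOne s))
      = ∑ r, ∑ y, ∑ i, V (gridPoint (r, i, y)) * V (gridPoint (r, i + j, y + s)) := by
  rw [← Equiv.sum_comp (Equiv.ofBijective _ gridPoint_bijective), Fintype.sum_prod_type]
  refine Finset.sum_congr rfl fun r _ => ?_
  rw [Fintype.sum_prod_type, Finset.sum_comm]
  simp only [Equiv.ofBijective_apply, gridPoint_add]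

theorem sum_zmod_three (f : ZMod 3 → ℤ) : ∑ i, f i = f 0 + f 1 + f 2 :=
  Fin.sum_univ_three f

theorem no_fixed_perfectArray_369 {V : ZMod 369 → ℤ} (hV : IsPerfectArray V (56 ^ 2))
    (h4 : ∀ z, V (4 * z) = V z) (hb : ∀ z, |V z| ≤ 17) : False := by
  have hpow : ∀ (k : ℕ) (z : ZMod 369), V (4 ^ k * z) = V z := fun k => by
    induction k with
    | zero => simp
    | succ k ih => intro z; rw [pow_succ, mul_assoc, ih, h4]
  -- Powers of the multiplier translate the two nontrivial cosets by 123, so a cubic character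
  -- annihilates them and only the subgroup contributes.
  have h1 : ∀ i y, V (gridPoint (1, i + 1, y)) = V (gridPoint (1, i, y)) := fun i y => by
    rw [← gridPoint_one_mul, ← hpow 20 (gridPoint (1, i, y)),
      show (4 : ZMod 369) ^ 20 = 124 by decide]
  have h2 : ∀ i y, V (gridPoint (2, i + 1, y)) = V (gridPoint (2, i, y)) := fun i y => by
    rw [← gridPoint_two_mul, ← hpow 10 (gridPoint (2, i, y)),
      show (4 : ZMod 369) ^ 10 = 247 by decide]
  have h11 : ∀ y, V (gridPoint (1, 1, y)) = V (gridPoint (1, 0, y)) := h1 0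
  have h12 : ∀ y, V (gridPoint (1, 2, y)) = V (gridPoint (1, 0, y)) := fun y =>
    (h1 1 y).trans (h11 y)
  have h21 : ∀ y, V (gridPoint (2, 1, y)) = V (gridPoint (2, 0, y)) := h2 0
  have h22 : ∀ y, V (gridPoint (2, 2, y)) = V (gridPoint (2, 0, y)) := fun y =>
    (h2 1 y).trans (h21 y)
  set x : ZMod 41 → ℤ × ℤ := fun y =>
    (V (gridPoint (0, 0, y)) - V (gridPoint (0, 2, y)),
      V (gridPoint (0, 1, y)) - V (gridPoint (0, 2, y))) with hx
  have hg : ∀ i y, V (gridPoint (0, i, 4 * y)) = V (gridPoint (0, i, y)) := fun i y => by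
    rw [← h4 (gridPoint (0, i, y))]
    simp [gridPoint, mul_add, embFortyOne_four_mul, four_mul_embThree]
  refine (quarticCorrelation_of_sum (x := x) (fun z => by simp only [hx, hg]) fun s => ?_).false ?_
  · have c0 := hV (embThree 0 + embFortyOne s)
    have c1 := hV (embThree 1 + embFortyOne s)
    have c2 := hV (embThree 2 + embFortyOne s)
    rw [sum_gridPoint] at c0 c1 c2
    simp only [emb_eq_zero_iff] at c0 c1 c2
    rw [if_neg (fun h => absurd h.1 (by decide))] at c1 c2
    simp only [true_and] at c0
    -- The coefficients `2, -1, -1` are the traces of `1, ω, ω²`.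
    have key : (if s = 0 then 6272 else 0 : ℤ)
        = 2 * (if s = 0 then ((56 ^ 2 : ℕ) : ℤ) else 0) - 0 - 0 := by
      split_ifs <;> norm_num
    rw [key, ← c0]
    nth_rw 1 [← c1]
    rw [← c2]
    simp only [Fin.sum_univ_three, sum_zmod_three, h11, h12, h21, h22, Finset.mul_sum, mul_add,
      ← Finset.sum_add_distrib, ← Finset.sum_sub_distrib]
    refine Finset.sum_congr rfl fun y _ => ?_
    simp only [hx, eisTrace, add_zero, zero_add, show (1 + 1 : ZMod 3) = 2 by decide,
      show (1 + 2 : ZMod 3) = 0 by decide, show (2 + 1 : ZMod 3) = 0 by decide,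
      show (2 + 2 : ZMod 3) = 1 by decide, h11, h12, h21, h22]
    ring
  · have hu : ∀ i, -17 ≤ V (gridPoint (0, i, 0)) ∧ V (gridPoint (0, i, 0)) ≤ 17 := fun i =>
      abs_le.1 (hb _)
    have e : quarticRep 0 = 0 := rfl
    simp only [e, hx, eisNorm]
    obtain ⟨a1, a2⟩ := hu 0
    obtain ⟨b1, b2⟩ := hu 1
    obtain ⟨c1, c2⟩ := hu 2
    generalize V (gridPoint (0, 0, 0)) = u at *
    generalize V (gridPoint (0, 1, 0)) = v at *
    generalize V (gridPoint (0, 2, 0)) = w at *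
    -- Half the sum of squared differences of three integers in `[-17, 17]` is at most `34 ^ 2 =
    -- 1156`.
    have : 2 * ((u - w) ^ 2 - (u - w) * (v - w) + (v - w) ^ 2)
        = (u - w) ^ 2 + (v - w) ^ 2 + (u - v) ^ 2 := by ring
    rcases le_total u v with h1 | h1 <;> rcases le_total v w with h2 | h2 <;>
      rcases le_total u w with h3 | h3 <;> nlinarith

/-! ### The case `m = 56` and the conclusion -/

theorem no_perfectArray_6273 {W : ZMod 6273 → ℤ} (hb : ∀ y, |W y| ≤ 1)
    (hW : IsPerfectArray W (56 ^ 2)) : False := by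
  have h : 369 ∣ 6273 := by norm_num
  have hX := hW.residueSum h
  have hbX := abs_residueSum_le h hb
  -- Modulo 369, `4 = 2 ^ 2 = 7 ^ 68`, a common power of the primes dividing 56.
  obtain ⟨c, hc⟩ := hX.exists_translate_fixed (by norm_num) (by norm_num) (t := (4 : ℕ))
    ((ZMod.isUnit_iff_coprime 4 369).2 (by norm_num)) fun p hp hd => by
      have hd' := hp.dvd_of_dvd_pow hd
      rw [show 56 = 2 ^ 3 * 7 by norm_num, hp.dvd_mul, Prime.dvd_pow_iff_dvd hp.prime three_ne_zero,
        Nat.prime_dvd_prime_iff_eq hp (by norm_num),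
        Nat.prime_dvd_prime_iff_eq hp (by norm_num)] at hd'
      rcases hd' with rfl | rfl
      exacts [⟨2, zmod_pow_eq (by norm_num)⟩, ⟨68, zmod_pow_eq (by norm_num)⟩]
  refine no_fixed_perfectArray_369 (hX.translate c) (fun z => hc z) fun z => ?_
  simpa using hbX (z + c)

theorem mainTheorem2 :
    ∀ n : ℕ, 6 < n → n ≤ 33895685 → ¬ ∃ a : ℕ → ℤ, IsPerfect n a 2 := by
  rintro n h6 hn ⟨a, ha⟩
  obtain ⟨m, u, rfl, hu, W, hb, hW⟩ := ha.1.exists_perfectArray (by omega)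
  rcases pell_solutions hu (by nlinarith) (by nlinarith) with rfl | rfl | rfl | rfl | rfl
  · exact no_perfectArray_33 hb hW
  · exact no_perfectArray_451 hb hW
  · exact no_perfectArray_6273 hb hW
  · exact no_perfectArray_87363 hb hW
  · exact no_perfectArray_1216801 hb hW
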